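/- For complex Hilbert spaces $H,K$, an operator $S\in B(K)$ is a dilation of $T\in B(H)$, and $T$ is a compression of $S$, if there is a linear isometry $X:H\to K$ with $X^*SX=T$; a unitary dilation is a dilation that is a unitary operator. Identify the set $M_n$ of $n\times n$ complex matrices with $B(\mathbb C^n)$. For $C\in M_n$ and $T\in B(H)$ with $\dim H\ge n$, let $$W_C(T)=\{\operatorname{tr}(CY): Y\in M_n \text{ is a compression of } T\}.$$ Theorem 1.2. Let $n\ge 2$, and let $C\in M_n$ be nonzero and not a rank-one normal matrix. Then there is a rank-one nilpotent matrix $T\in M_n$ with operator norm $\|T\|\le 1$ such that, for some $r\ge 0$, $$W_C(T)=\{z\in\mathbb C: |z|\le r\},$$ and there is $d>0$ such that $r+d\in \operatorname{cl}(W_C(U))$ for every unitary dilation $U$ of $T$ (on any complex Hilbert space). Consequently, $W_C(T)=\operatorname{cl}(W_C(T))$ is a proper subset of $$\bigcap\{\operatorname{cl}(W_C(U)): U \text{ is a unitary dilation of } T\}.$$ -/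

import Mathlib

universe u v w

/-- The operator on the Hilbert space `ℂⁿ` given by an `n × n` complex matrix. -/
noncomputable abbrev matOp {n : ℕ} (A : Matrix (Fin n) (Fin n) ℂ) :
    EuclideanSpace ℂ (Fin n) →L[ℂ] EuclideanSpace ℂ (Fin n) :=
  Matrix.toEuclideanCLM (n := Fin n) (𝕜 := ℂ) A

/-- `S ∈ B(K)` is a dilation of `T ∈ B(H)` (equivalently `T` is a compression of `S`):
there is an isometry `X : H → K` (that is, `X* X = 1`) with `X* S X = T`. -/
def IsDilation {H : Type v} {K : Type w}
    [NormedAddCommGroup H] [InnerProductSpace ℂ H] [CompleteSpace H]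
    [NormedAddCommGroup K] [InnerProductSpace ℂ K] [CompleteSpace K]
    (S : K →L[ℂ] K) (T : H →L[ℂ] H) : Prop :=
  ∃ X : H →ₗᵢ[ℂ] K,
    (ContinuousLinearMap.adjoint X.toContinuousLinearMap).comp
      (S.comp X.toContinuousLinearMap) = T

/-- `U ∈ B(K)` is a unitary dilation of `T ∈ B(H)`. -/
def IsUnitaryDilation {H : Type v} {K : Type w}
    [NormedAddCommGroup H] [InnerProductSpace ℂ H] [CompleteSpace H]
    [NormedAddCommGroup K] [InnerProductSpace ℂ K] [CompleteSpace K]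
    (U : K →L[ℂ] K) (T : H →L[ℂ] H) : Prop :=
  U ∈ unitary (K →L[ℂ] K) ∧ IsDilation U T

/-- The `C`-numerical range `W_C(T) = {tr (C Y) : Y ∈ M_n is a compression of T}`. -/
def cNumericalRange {n : ℕ} (C : Matrix (Fin n) (Fin n) ℂ) {H : Type v}
    [NormedAddCommGroup H] [InnerProductSpace ℂ H] [CompleteSpace H]
    (T : H →L[ℂ] H) : Set ℂ :=
  {z | ∃ Y : Matrix (Fin n) (Fin n) ℂ, IsDilation T (matOp Y) ∧ (C * Y).trace = z}

/-- The intersection of `cl (W_C(U))` over all unitary dilations `U` of `T`, on arbitrary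
complex Hilbert spaces (of the universe `u`). -/
def dilationIntersection {n : ℕ} (C : Matrix (Fin n) (Fin n) ℂ) {H : Type v}
    [NormedAddCommGroup H] [InnerProductSpace ℂ H] [CompleteSpace H]
    (T : H →L[ℂ] H) : Set ℂ :=
  {z | ∀ (K : Type u) [NormedAddCommGroup K] [InnerProductSpace ℂ K] [CompleteSpace K]
    (U : K →L[ℂ] K), IsUnitaryDilation U T → z ∈ closure (cNumericalRange C U)}

/-!
Write `⟨x, y⟩` for the inner product, conjugate-linear in `x`. The matrix `T` is `a e f*`, where the
orthonormal pair `(e, f)` maximizes `|⟨f, C e⟩|` over orthonormal pairs, with maximum `r`, and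
`0 < a ≤ 1`. The compressions of `T` to `ℂⁿ` are the operators `a e' f'*` with `(e', f')`
orthonormal, so that `W_C(T)` is the disc of radius `a r`
(`IsExtremalPair.exists_trace_compression_eq_iff`).

Let `U` be a unitary dilation of `T`, with isometry `V`. To exceed `a r`, rotate one vector `V w`
towards a unit vector `m` orthogonal to the range of `V`; the trace `tr (C V* U V)` then has an
explicit second-order expansion in the angle (`norm_trace_increment_sub_le`), with constants that do
not depend on `U`. The value has to be `a r + d` exactly, not just of large real part. This is
achieved by also rotating the phase of `V f`: for each angle the values form an ellipse, which is
the circle of radius `a r` at angle `0` and encloses `a r + d` at the end of the path, so one of the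
ellipses passes through `a r + d` (`exists_ellipse_eq`, `exists_isometry_trace_eq`).

If `r > 0`, a gain comes from one of two sources.

* First order. The vectors `U* V x - V T* x` and `U V x - V T x` have square norms
  `‖x‖² - ‖T* x‖²` and `‖x‖² - ‖T x‖²`, so the gradient (`traceGradient`) can only vanish if
  `C (1 - T T*) C* = C* (1 - T* T) C`. If this fails for some `a` in `(0, 1)`, the gradient is
  bounded below for all `U` (`exceedsOnDilations_of_norm_sq_ne`).
* Second order. If it holds for all `a`, then `C` is normal and `C e = r (ω e + f) = ω C* f` with
  `|ω| = 1` (`IsExtremalPair.normal_of_norm_sq_eq`). For `m` in the direction of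
  `U* V C* v - V T* C* v`, a gradient that is small at `v` determines `⟨m, U m⟩` up to a small
  error, and hence the second variation, which is made positive by a choice of `v`, `w` and `a`
  unless `C` has rank one (`IsExtremalPair.exists_second_order`, `exceedsOnDilations_of_second_order`).
  So, for each `U`, either the gradient at `v` is large or the second variation is positive.

If `r = 0`, then `C` is scalar. With `a = 1` one has `U V f = V e`, and the numerical range of the
compression of `U` to the span of `V e` and `U V e` contains a fixed disc about `0`
(`exceedsOnDilations_of_eigenvector`).
-/

open InnerProductSpace ContinuousLinearMap ComplexConjugate

/-! ### Compressions and traces -/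

/-- The compression `V* S V` of `S` by an isometry `V`. -/
noncomputable def compression {H : Type v} {K : Type w}
    [NormedAddCommGroup H] [InnerProductSpace ℂ H] [CompleteSpace H]
    [NormedAddCommGroup K] [InnerProductSpace ℂ K] [CompleteSpace K]
    (S : K →L[ℂ] K) (V : H →ₗᵢ[ℂ] K) : H →L[ℂ] H :=
  (adjoint V.toContinuousLinearMap).comp (S.comp V.toContinuousLinearMap)

theorem inner_compression {H : Type v} {K : Type w}
    [NormedAddCommGroup H] [InnerProductSpace ℂ H] [CompleteSpace H]
    [NormedAddCommGroup K] [InnerProductSpace ℂ K] [CompleteSpace K]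
    (S : K →L[ℂ] K) (V : H →ₗᵢ[ℂ] K) (x y : H) :
    inner ℂ x (compression S V y) = inner ℂ (V x) (S (V y)) := by
  simp [compression, adjoint_inner_right]

/-- The trace of a bounded operator on a finite-dimensional space, as a linear functional. -/
noncomputable def opTrace (H : Type v) [NormedAddCommGroup H] [InnerProductSpace ℂ H] :
    (H →L[ℂ] H) →ₗ[ℂ] ℂ :=
  (LinearMap.trace ℂ H).comp (ContinuousLinearMap.coeLM ℂ)

theorem opTrace_apply {H : Type v} [NormedAddCommGroup H] [InnerProductSpace ℂ H]
    (L : H →L[ℂ] H) : opTrace H L = LinearMap.trace ℂ H (L : H →ₗ[ℂ] H) := rfl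

/-- Rotating the unit vector `V w` towards a unit vector `m` orthogonal to the range of `V`. -/
theorem exists_rotated_isometry {H : Type v} {K : Type w}
    [NormedAddCommGroup H] [InnerProductSpace ℂ H] [NormedAddCommGroup K] [InnerProductSpace ℂ K]
    (V : H →ₗᵢ[ℂ] K) {w : H} {m : K} (hw : ‖w‖ = 1) (hm : ‖m‖ = 1)
    (hp : ∀ x, inner ℂ (V x) m = 0) {c s : ℂ} (hcs : ‖c‖ ^ 2 + ‖s‖ ^ 2 = 1) :
    ∃ V' : H →ₗᵢ[ℂ] K, ∀ x, V' x = V x + inner ℂ w x • ((c - 1) • V w + s • m) := by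
  let A : H →ₗ[ℂ] K := V.toLinearMap +
    (rankOne ℂ ((c - 1) • V w + s • m) w : H →L[ℂ] K).toLinearMap
  have hA : ∀ x, A x = V x + inner ℂ w x • ((c - 1) • V w + s • m) := fun x => by
    simp [A]; module
  have hp' : ∀ x, inner ℂ m (V x) = 0 := fun x => by rw [← inner_conj_symm, hp]; simp
  have h1 : conj c * c + conj s * s = (1 : ℂ) := by
    rw [Complex.conj_mul', Complex.conj_mul']; exact_mod_cast hcs
  have hww : inner ℂ w w = (1 : ℂ) := by rw [inner_self_eq_norm_sq_to_K, hw]; simp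
  have hmm : inner ℂ m m = (1 : ℂ) := by rw [inner_self_eq_norm_sq_to_K, hm]; simp
  refine ⟨A.isometryOfInner fun x y => ?_, hA⟩
  rw [hA, hA]
  simp only [inner_add_left, inner_add_right, inner_smul_left, inner_smul_right, hp, hp',
    LinearIsometry.inner_map_map, hww, hmm, map_sub, map_one]
  rw [← inner_conj_symm x w]
  linear_combination (conj (inner ℂ w x)) * (inner ℂ w y) * h1

/-- The unitary that multiplies the unit vector `f` by a phase and fixes its complement. -/
theorem exists_phase_isometry {H : Type v} [NormedAddCommGroup H] [InnerProductSpace ℂ H]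
    {f : H} (hf : ‖f‖ = 1) {ζ : ℂ} (hζ : ‖ζ‖ = 1) :
    ∃ R : H →ₗᵢ[ℂ] H, ∀ x, R x = x + inner ℂ f x • ((ζ - 1) • f) := by
  let A : H →ₗ[ℂ] H := LinearMap.id +
    (rankOne ℂ ((ζ - 1) • f) f : H →L[ℂ] H).toLinearMap
  have hA : ∀ x, A x = x + inner ℂ f x • ((ζ - 1) • f) := fun x => by simp [A]; module
  have h1 : conj ζ * ζ = (1 : ℂ) := by
    rw [Complex.conj_mul', hζ]; simp
  have hff : inner ℂ f f = (1 : ℂ) := by rw [inner_self_eq_norm_sq_to_K, hf]; simp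
  refine ⟨A.isometryOfInner fun x y => ?_, hA⟩
  rw [hA, hA]
  simp only [inner_add_left, inner_add_right, inner_smul_left, inner_smul_right,
    hff, map_sub, map_one]
  rw [← inner_conj_symm x f]
  linear_combination (conj (inner ℂ f x)) * (inner ℂ f y) * h1

section

variable {H : Type v} {K : Type w}
  [NormedAddCommGroup H] [InnerProductSpace ℂ H] [FiniteDimensional ℂ H]
  [NormedAddCommGroup K] [InnerProductSpace ℂ K] [CompleteSpace K]

theorem opTrace_rankOne (x y : H) : opTrace H (rankOne ℂ x y) = inner ℂ y x := by
  rw [opTrace_apply, trace_rankOne]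

theorem opTrace_comp_rankOne (C : H →L[ℂ] H) (x y : H) :
    opTrace H (C ∘L rankOne ℂ x y) = inner ℂ y (C x) := by
  rw [comp_rankOne, opTrace_rankOne]

/-- Changing an isometry in a single direction `w` changes the compression by operators of rank
one. -/
theorem compression_eq_of_apply_eq (S : K →L[ℂ] K) (V V' : H →ₗᵢ[ℂ] K) (w : H) (z : K)
    (h : ∀ x, V' x = V x + inner ℂ w x • z) :
    compression S V' = compression S V
      + rankOne ℂ (adjoint V.toContinuousLinearMap (S z)) w
      + rankOne ℂ w (adjoint V.toContinuousLinearMap (adjoint S z))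
      + inner ℂ z (S z) • rankOne ℂ w w := by
  ext1 y
  refine ext_inner_left ℂ fun x => ?_
  rw [inner_compression, h, h]
  simp [inner_add_right, inner_smul_right, inner_compression,
    adjoint_inner_right, adjoint_inner_left]
  ring

theorem opTrace_comp_compression_of_apply_eq (C : H →L[ℂ] H) (S : K →L[ℂ] K)
    (V V' : H →ₗᵢ[ℂ] K) (w : H) (z : K) (h : ∀ x, V' x = V x + inner ℂ w x • z) :
    opTrace H (C ∘L compression S V') = opTrace H (C ∘L compression S V)
      + inner ℂ (V (adjoint C w)) (S z) + inner ℂ z (S (V (C w)))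
      + inner ℂ z (S z) * inner ℂ w (C w) := by
  rw [compression_eq_of_apply_eq S V V' w z h]
  simp only [comp_add, map_add, comp_smul, map_smul, opTrace_comp_rankOne, smul_eq_mul]
  congr 2
  · congr 1
    rw [← adjoint_inner_left, adjoint_inner_right]; rfl
  · rw [adjoint_inner_left, adjoint_inner_left]; rfl

/-- As the phase `ζ` of `V f` varies, the values `tr (C V* S V)` run through an ellipse. -/
theorem exists_isometry_trace_phase (C : H →L[ℂ] H) (S : K →L[ℂ] K) (V : H →ₗᵢ[ℂ] K) {f : H}
    (hf : ‖f‖ = 1) {ζ : ℂ} (hζ : ‖ζ‖ = 1) (L : H →L[ℂ] H) (hL : L = compression S V) :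
    ∃ V' : H →ₗᵢ[ℂ] K, opTrace H (C ∘L compression S V') =
      (opTrace H (C ∘L L) - inner ℂ f (C (L f)) - inner ℂ f (L (C f))
          + 2 * (inner ℂ f (L f) * inner ℂ f (C f)))
        + ζ * (inner ℂ f (C (L f)) - inner ℂ f (L f) * inner ℂ f (C f))
        + conj ζ * (inner ℂ f (L (C f)) - inner ℂ f (L f) * inner ℂ f (C f)) := by
  obtain ⟨R, hR⟩ := exists_phase_isometry hf hζ
  refine ⟨V.comp R, ?_⟩
  have h1 : conj ζ * ζ = (1 : ℂ) := by
    rw [Complex.conj_mul', hζ]; simp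
  have h := opTrace_comp_compression_of_apply_eq C S V (V.comp R) f ((ζ - 1) • V f)
    (fun x => by simp [hR])
  rw [h, ← hL]
  simp only [map_smul, inner_smul_left, inner_smul_right, map_sub, map_one]
  rw [← inner_compression, ← inner_compression, ← inner_compression, ← hL, adjoint_inner_left]
  linear_combination (inner ℂ f (L f) * inner ℂ f (C f)) * h1

end

section

variable {n : ℕ}

theorem trace_mul_eq_opTrace (A B : Matrix (Fin n) (Fin n) ℂ) :
    (A * B).trace = opTrace _ (matOp A ∘L matOp B) := by
  have : matOp A ∘L matOp B = matOp (A * B) :=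
    (map_mul (Matrix.toEuclideanCLM (n := Fin n) (𝕜 := ℂ)) A B).symm
  rw [this, opTrace_apply, Matrix.coe_toEuclideanCLM_eq_toEuclideanLin,
    Matrix.toEuclideanLin_eq_toLin_orthonormal]
  simp

theorem mem_cNumericalRange_iff (C : Matrix (Fin n) (Fin n) ℂ) {K : Type w}
    [NormedAddCommGroup K] [InnerProductSpace ℂ K] [CompleteSpace K] (S : K →L[ℂ] K) (z : ℂ) :
    z ∈ cNumericalRange C S ↔ ∃ V : EuclideanSpace ℂ (Fin n) →ₗᵢ[ℂ] K,
      opTrace _ (matOp C ∘L compression S V) = z := by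
  constructor
  · rintro ⟨Y, ⟨V, hV⟩, rfl⟩
    exact ⟨V, by rw [trace_mul_eq_opTrace, ← hV]; rfl⟩
  · rintro ⟨V, rfl⟩
    obtain ⟨Y, hY⟩ := (Matrix.toEuclideanCLM (n := Fin n) (𝕜 := ℂ)).surjective (compression S V)
    exact ⟨Y, ⟨V, hY.symm⟩, by rw [trace_mul_eq_opTrace, ← hY]; rfl⟩

end

/-! ### Ellipses through a point -/

/-- Let the ellipses `ζ ↦ A s + ζ B s + conj ζ D s` (`‖ζ‖ = 1`) start at `s = 0` from the circle of
radius `ρ` about `0` and stay close to it. If the point `A + B + D` of the last ellipse lies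
sufficiently far to the right of `ρ + d`, then one of the ellipses passes exactly through
`ρ + d`. -/
theorem exists_ellipse_eq {A B D : ℝ → ℂ} {σ ρ d η : ℝ}
    (hA : ContinuousOn A (Set.Icc 0 σ)) (hB : ContinuousOn B (Set.Icc 0 σ))
    (hD : ContinuousOn D (Set.Icc 0 σ)) (hσ : 0 ≤ σ) (hA0 : A 0 = 0) (hB0 : B 0 = ρ)
    (hD0 : D 0 = 0) (hρ : 0 < ρ) (hd : 0 ≤ d) (hη : 4 * η ≤ ρ)
    (hBη : ∀ s ∈ Set.Icc 0 σ, ‖B s - ρ‖ ≤ η) (hDη : ∀ s ∈ Set.Icc 0 σ, ‖D s‖ ≤ η)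
    (hq : 5 * ‖A σ + B σ + D σ - (ρ + d)‖ ^ 2 + 4 * η * ‖A σ + B σ + D σ - (ρ + d)‖
      ≤ 2 * ρ * (A σ + B σ + D σ - (ρ + d)).re) :
    ∃ s ∈ Set.Icc 0 σ, ∃ ζ : ℂ, ‖ζ‖ = 1 ∧ A s + ζ * B s + conj ζ * D s = ρ + d := by
  have hBl : ∀ s ∈ Set.Icc 0 σ, 3 / 4 * ρ ≤ ‖B s‖ := fun s hs => by
    have h1 := hBη s hs
    have h2 : ‖(ρ : ℂ)‖ ≤ ‖B s‖ + ‖B s - ρ‖ := by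
      have := norm_sub_le (B s) (B s - ρ)
      simpa using this
    rw [Complex.norm_real, Real.norm_of_nonneg hρ.le] at h2
    linarith
  have hΔ : ∀ s ∈ Set.Icc 0 σ, ρ ^ 2 / 2 ≤ ‖B s‖ ^ 2 - ‖D s‖ ^ 2 := fun s hs => by
    have h1 := hBl s hs
    have h2 := hDη s hs
    have h3 := norm_nonneg (D s)
    nlinarith
  have hΔ0 : ∀ s ∈ Set.Icc 0 σ, ((‖B s‖ ^ 2 - ‖D s‖ ^ 2 : ℝ) : ℂ) ≠ 0 := fun s hs => by
    have := hΔ s hs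
    have h4 : 0 < ρ ^ 2 := by positivity
    exact_mod_cast (by linarith : (0:ℝ) < ‖B s‖ ^ 2 - ‖D s‖ ^ 2).ne'
  -- The solution of `ρ + d = A + ζ B + conj ζ D` for `ζ`.
  let Z : ℝ → ℂ := fun s => (conj (B s) * (ρ + d - A s) - D s * conj (ρ + d - A s)) /
    ((‖B s‖ ^ 2 - ‖D s‖ ^ 2 : ℝ) : ℂ)
  have hZ : ∀ s ∈ Set.Icc 0 σ, A s + Z s * B s + conj (Z s) * D s = ρ + d := fun s hs => by
    have h0 := hΔ0 s hs
    simp only [Z, map_div₀, map_sub, map_mul, Complex.conj_conj, Complex.conj_ofReal, map_add]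
    field_simp
    push_cast
    rw [← Complex.conj_mul', ← Complex.conj_mul']
    ring
  have hZc : ContinuousOn Z (Set.Icc 0 σ) := by
    refine ContinuousOn.div ?_ ?_ hΔ0
    · exact ((Complex.continuous_conj.comp_continuousOn hB).mul (continuousOn_const.sub hA)).sub
        (hD.mul (Complex.continuous_conj.comp_continuousOn (continuousOn_const.sub hA)))
    · exact Complex.continuous_ofReal.comp_continuousOn ((hB.norm.pow 2).sub (hD.norm.pow 2))
  have hZ0 : 1 ≤ ‖Z 0‖ := by
    have h1 : Z 0 = ((ρ + d) / ρ : ℝ) := by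
      have hρ' : (ρ : ℂ) ≠ 0 := by exact_mod_cast hρ.ne'
      simp only [Z, hA0, hB0, hD0]
      simp [abs_of_pos hρ]
      field_simp
    rw [h1, Complex.norm_real, Real.norm_of_nonneg (by positivity), le_div_iff₀ hρ]
    linarith
  have hσ' : σ ∈ Set.Icc 0 σ := ⟨hσ, le_rfl⟩
  have hZ1 : ‖Z σ‖ ≤ 1 := by
    set q := A σ + B σ + D σ - (ρ + d) with hq'
    set N := conj (B σ) * q - D σ * conj q with hN
    have hΔσ := hΔ σ hσ'
    set Δ := ‖B σ‖ ^ 2 - ‖D σ‖ ^ 2 with hΔd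
    have hΔp : 0 < Δ := by have : 0 < ρ ^ 2 := by positivity
                           linarith
    have h1 : Z σ * Δ = Δ - N := by
      simp only [Z, ← hΔd]
      rw [div_mul_cancel₀ _ (by exact_mod_cast hΔp.ne'), hΔd]
      push_cast
      rw [← Complex.conj_mul', ← Complex.conj_mul', hN, hq']
      simp only [map_add, map_sub, Complex.conj_ofReal]
      ring
    have hBσ := hBη σ hσ'
    have hDσ := hDη σ hσ'
    have hre : ρ * q.re - 2 * η * ‖q‖ ≤ N.re := by
      have h2 : N = ρ * q + (conj (B σ - ρ) * q - D σ * conj q) := by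
        rw [hN]; simp only [map_sub, Complex.conj_ofReal]; ring
      have h3 : ‖conj (B σ - ρ) * q - D σ * conj q‖ ≤ 2 * η * ‖q‖ := by
        refine (norm_sub_le _ _).trans ?_
        rw [norm_mul, norm_mul, Complex.norm_conj, Complex.norm_conj]
        have := norm_nonneg q
        nlinarith
      have h4 := (abs_le.1 ((Complex.abs_re_le_norm _).trans h3)).1
      rw [h2, Complex.add_re, Complex.re_ofReal_mul]
      linarith
    have hNn : ‖N‖ ≤ 3 / 2 * ρ * ‖q‖ := by
      have h5 : ‖B σ‖ ≤ ρ + η := by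
        have := norm_add_le (B σ - ρ) (ρ : ℂ)
        rw [sub_add_cancel, Complex.norm_real, Real.norm_of_nonneg hρ.le] at this
        linarith
      refine (norm_sub_le _ _).trans ?_
      rw [norm_mul, norm_mul, Complex.norm_conj, Complex.norm_conj]
      have := norm_nonneg q
      nlinarith
    have h6 : ‖(Δ : ℂ) - N‖ ^ 2 = Δ ^ 2 - 2 * Δ * N.re + ‖N‖ ^ 2 := by
      rw [Complex.sq_norm, Complex.sq_norm, Complex.normSq_apply, Complex.normSq_apply]
      simp
      ring
    have h7 : ‖N‖ ^ 2 ≤ 2 * Δ * N.re := by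
      have h8 : ‖N‖ ^ 2 ≤ (3 / 2 * ρ * ‖q‖) ^ 2 := by gcongr
      have h9 : 5 * ‖q‖ ^ 2 ≤ 2 * N.re := by linarith
      nlinarith [sq_nonneg ‖q‖, mul_le_mul hΔσ h9 (by positivity) hΔp.le,
        mul_nonneg (sq_nonneg ρ) (sq_nonneg ‖q‖)]
    have h10 : ‖(Δ : ℂ) - N‖ ≤ Δ := by
      refine abs_le_of_sq_le_sq' ?_ hΔp.le |>.2
      linarith
    rw [← h1, norm_mul, Complex.norm_real, Real.norm_of_nonneg hΔp.le] at h10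
    exact le_of_mul_le_mul_right (by linarith) hΔp
  obtain ⟨s, hs, hs1⟩ := intermediate_value_Icc' hσ hZc.norm ⟨hZ1, hZ0⟩
  exact ⟨s, hs, Z s, hs1, hZ s hs⟩

/-! ### Rotating an isometry -/

theorem norm_inner_apply_le_of_isometry {K : Type w} [NormedAddCommGroup K]
    [InnerProductSpace ℂ K] {U : K →L[ℂ] K} (hU : ∀ x, ‖U x‖ = ‖x‖) (x y : K) :
    ‖inner ℂ x (U y)‖ ≤ ‖x‖ * ‖y‖ := by
  simpa [hU] using norm_inner_le_norm (𝕜 := ℂ) x (U y)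

section

variable {H : Type v} {K : Type w}
  [NormedAddCommGroup H] [InnerProductSpace ℂ H] [FiniteDimensional ℂ H]
  [NormedAddCommGroup K] [InnerProductSpace ℂ K] [CompleteSpace K]

theorem norm_inner_sub_compression_le {U : K →L[ℂ] K} (hU : ∀ x, ‖U x‖ = ‖x‖)
    (V V' : H →ₗᵢ[ℂ] K) {w : H} (hw : ‖w‖ = 1) {z : K} (h : ∀ x, V' x = V x + inner ℂ w x • z)
    (x y : H) :
    ‖inner ℂ x (compression U V' y) - inner ℂ x (compression U V y)‖ ≤ 2 * ‖z‖ * ‖x‖ * ‖y‖ := by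
  rw [inner_compression, inner_compression]
  have hd : ∀ x, ‖V' x - V x‖ ≤ ‖z‖ * ‖x‖ := fun x => by
    rw [h, add_sub_cancel_left, norm_smul]
    have := norm_inner_le_norm (𝕜 := ℂ) w x
    rw [hw, one_mul] at this
    rw [mul_comm]
    gcongr
  have e : inner ℂ (V' x) (U (V' y)) - inner ℂ (V x) (U (V y))
      = inner ℂ (V' x - V x) (U (V' y)) + inner ℂ (V x) (U (V' y - V y)) := by
    rw [map_sub, inner_sub_left, inner_sub_right]; ring
  rw [e]
  refine (norm_add_le _ _).trans ?_
  have h1 := norm_inner_apply_le_of_isometry hU (V' x - V x) (V' y)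
  have h2 := norm_inner_apply_le_of_isometry hU (V x) (V' y - V y)
  rw [LinearIsometry.norm_map] at h1 h2
  have h3 := mul_le_mul_of_nonneg_right (hd x) (norm_nonneg y)
  have h4 := mul_le_mul_of_nonneg_left (hd y) (norm_nonneg x)
  linarith

/-- Moving `V w` towards a unit vector `m` orthogonal to the range of `V`, and rotating the phase
of `V f`, one reaches the value `ρ + d` exactly as soon as the trace at the end of the path
exceeds `ρ + d` by a complex number `q` whose real part dominates. -/
theorem exists_isometry_trace_eq (C : H →L[ℂ] H) {U : K →L[ℂ] K} (hU : ∀ x, ‖U x‖ = ‖x‖)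
    (V : H →ₗᵢ[ℂ] K) {e f : H} (hf : ‖f‖ = 1) (hef : inner ℂ f e = 0)
    {a r : ℝ} (hρ : 0 < a * r) (hCe : inner ℂ f (C e) = r)
    (hT : compression U V = (a : ℂ) • rankOne ℂ e f) {w : H} {m : K} (hw : ‖w‖ = 1)
    (hm : ‖m‖ = 1) (hp : ∀ x, inner ℂ (V x) m = 0) {σ d : ℝ} (hσ : 0 ≤ σ) (hσ1 : σ ≤ 1)
    (hd : 0 ≤ d) (hη : 32 * ‖C‖ * σ ≤ a * r) {z : K}
    (hz : z = ((√(1 - σ ^ 2) : ℝ) - 1 : ℂ) • V w + (σ : ℂ) • m) {q : ℂ}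
    (hq : q = inner ℂ (V (adjoint C w)) (U z) + inner ℂ z (U (V (C w)))
      + inner ℂ z (U z) * inner ℂ w (C w) - d)
    (hqq : 5 * ‖q‖ ^ 2 + 32 * ‖C‖ * σ * ‖q‖ ≤ 2 * (a * r) * q.re) :
    ∃ V' : H →ₗᵢ[ℂ] K, opTrace H (C ∘L compression U V') = (a * r : ℝ) + d := by
  let zs : ℝ → K := fun s => ((√(1 - s ^ 2) : ℝ) - 1 : ℂ) • V w + (s : ℂ) • m
  have hzc : Continuous zs := by fun_prop
  have hV : ∀ s ∈ Set.Icc 0 σ, ∃ V' : H →ₗᵢ[ℂ] K, ∀ x, V' x = V x + inner ℂ w x • zs s := by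
    intro s hs
    refine exists_rotated_isometry V hw hm hp ?_
    have h1 : s ^ 2 ≤ 1 := by nlinarith [hs.1, hs.2]
    rw [Complex.norm_real, Complex.norm_real, Real.norm_eq_abs, Real.norm_eq_abs, sq_abs, sq_abs,
      Real.sq_sqrt (by linarith)]
    ring
  have hzn : ∀ s ∈ Set.Icc 0 σ, ‖zs s‖ ≤ 2 * σ := by
    intro s hs
    have h1 : s ^ 2 ≤ 1 := by nlinarith [hs.1, hs.2]
    have h2 : √(1 - s ^ 2) ≤ 1 := Real.sqrt_le_one.2 (by nlinarith)
    have h3 : 1 - s ≤ √(1 - s ^ 2) := Real.le_sqrt_of_sq_le (by nlinarith [hs.1, hs.2])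
    refine (norm_add_le _ _).trans ?_
    have h4 : ((√(1 - s ^ 2) : ℝ) - 1 : ℂ) = ((√(1 - s ^ 2) - 1 : ℝ) : ℂ) := by push_cast; rfl
    rw [norm_smul, norm_smul, LinearIsometry.norm_map, hw, hm, h4, Complex.norm_real,
      Complex.norm_real, Real.norm_of_nonneg hs.1, Real.norm_of_nonpos (by linarith)]
    linarith [hs.2]
  let L : ℝ → (H →L[ℂ] H) := fun s => compression U V
      + rankOne ℂ (adjoint V.toContinuousLinearMap (U (zs s))) w
      + rankOne ℂ w (adjoint V.toContinuousLinearMap (adjoint U (zs s)))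
      + inner ℂ (zs s) (U (zs s)) • rankOne ℂ w w
  have hL : ∀ s (V' : H →ₗᵢ[ℂ] K), (∀ x, V' x = V x + inner ℂ w x • zs s) →
      L s = compression U V' := fun s V' h => (compression_eq_of_apply_eq U V V' w (zs s) h).symm
  have hLc : Continuous L := by
    have h1 : Continuous fun s => rankOne ℂ (adjoint V.toContinuousLinearMap (U (zs s))) w :=
      ((rankOne ℂ (E := H) (F := H)).flip w).continuous.comp (by fun_prop)
    have h2 : Continuous fun s =>
        rankOne ℂ w (adjoint V.toContinuousLinearMap (adjoint U (zs s))) :=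
      (rankOne ℂ w : H →L⋆[ℂ] (H →L[ℂ] H)).continuous.comp (by fun_prop)
    have h3 : Continuous fun s => inner ℂ (zs s) (U (zs s)) := by fun_prop
    exact ((continuous_const.add h1).add h2).add (h3.smul continuous_const)
  have htr : Continuous fun s => opTrace H (C ∘L L s) := by
    have : Continuous (opTrace H) := LinearMap.continuous_of_finiteDimensional _
    exact this.comp (by fun_prop)
  have hLd : ∀ s ∈ Set.Icc 0 σ, ∀ x y,
      ‖inner ℂ x (L s y) - inner ℂ x (compression U V y)‖ ≤ 4 * σ * ‖x‖ * ‖y‖ := by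
    intro s hs x y
    obtain ⟨V', hV'⟩ := hV s hs
    rw [hL s V' hV']
    refine (norm_inner_sub_compression_le hU V V' hw hV' x y).trans ?_
    have : 2 * ‖zs s‖ ≤ 4 * σ := by linarith [hzn s hs]
    gcongr
  have hL0 : L 0 = (a : ℂ) • rankOne ℂ e f := by
    rw [← hT]; simp [L, zs]
  have hff : inner ℂ f f = (1 : ℂ) := by rw [inner_self_eq_norm_sq_to_K, hf]; simp
  have hCf : ‖C f‖ ≤ ‖C‖ := by simpa [hf] using C.le_opNorm f
  have hCaf : ‖adjoint C f‖ ≤ ‖C‖ := by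
    have := (adjoint C).le_opNorm f
    rwa [hf, mul_one, LinearIsometryEquiv.norm_map] at this
  have hγ : ‖inner ℂ f (C f)‖ ≤ ‖C‖ := by
    refine (norm_inner_le_norm _ _).trans ?_
    rwa [hf, one_mul]
  have hb2 : ∀ s ∈ Set.Icc 0 σ, ‖inner ℂ f (L s f) * inner ℂ f (C f)‖ ≤ 4 * ‖C‖ * σ := by
    intro s hs
    have := hLd s hs f f
    rw [hT] at this
    simp only [smul_apply, rankOne_apply, inner_smul_right, hef, hf, mul_zero, sub_zero,
      mul_one] at this
    rw [norm_mul]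
    calc _ ≤ 4 * σ * ‖C‖ := by gcongr
      _ = _ := by ring
  obtain ⟨s, hs, ζ, hζ, h⟩ := exists_ellipse_eq (σ := σ) (ρ := a * r) (d := d) (η := 8 * ‖C‖ * σ)
    (A := fun s => opTrace H (C ∘L L s) - inner ℂ f (C (L s f)) - inner ℂ f (L s (C f))
          + 2 * (inner ℂ f (L s f) * inner ℂ f (C f)))
    (B := fun s => inner ℂ f (C (L s f)) - inner ℂ f (L s f) * inner ℂ f (C f))
    (D := fun s => inner ℂ f (L s (C f)) - inner ℂ f (L s f) * inner ℂ f (C f))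
    (by fun_prop) (by fun_prop) (by fun_prop) hσ
    (by
      simp only [hL0]
      simp [opTrace_comp_rankOne, comp_smul, hf, hef, hCe])
    (by
      simp only [hL0]
      simp [hf, hef, hCe])
    (by
      simp only [hL0]
      simp [hef])
    hρ hd (by linarith)
    (by
      intro s hs
      have h1 := hLd s hs (adjoint C f) f
      rw [hT] at h1
      simp only [smul_apply, rankOne_apply, inner_smul_right, hff, one_smul,
        hf, mul_one, adjoint_inner_left, hCe] at h1
      have h2 := hb2 s hs
      have h3 : 4 * σ * ‖adjoint C f‖ ≤ 4 * σ * ‖C‖ := by gcongr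
      push_cast
      calc _ = ‖(inner ℂ f (C (L s f)) - a * r) - inner ℂ f (L s f) * inner ℂ f (C f)‖ := by
            congr 1; ring
        _ ≤ _ := norm_sub_le _ _
        _ ≤ _ := by linarith)
    (by
      intro s hs
      have h1 := hLd s hs f (C f)
      rw [hT] at h1
      simp only [smul_apply, rankOne_apply, inner_smul_right, hef, mul_zero, sub_zero,
        hf, mul_one] at h1
      have h2 := hb2 s hs
      have h3 : 4 * σ * ‖C f‖ ≤ 4 * σ * ‖C‖ := by gcongr
      refine (norm_sub_le _ _).trans (by linarith))
    (by
      obtain ⟨V', hV'⟩ := hV σ ⟨hσ, le_rfl⟩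
      have h1 := opTrace_comp_compression_of_apply_eq C U V V' w (zs σ) hV'
      rw [hT, ← hL σ V' hV', comp_smul, map_smul, opTrace_comp_rankOne, hCe] at h1
      have h2 : zs σ = z := hz.symm
      have h3 : (opTrace H (C ∘L L σ) - inner ℂ f (C (L σ f)) - inner ℂ f (L σ (C f))
          + 2 * (inner ℂ f (L σ f) * inner ℂ f (C f)))
          + (inner ℂ f (C (L σ f)) - inner ℂ f (L σ f) * inner ℂ f (C f))
          + (inner ℂ f (L σ (C f)) - inner ℂ f (L σ f) * inner ℂ f (C f))
          - (((a * r : ℝ) : ℂ) + d) = q := by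
        rw [hq, h1, h2]
        push_cast
        simp only [smul_eq_mul]
        ring
      simp only [h3]
      linarith)
  obtain ⟨V', hV'⟩ := hV s hs
  obtain ⟨V'', h''⟩ := exists_isometry_trace_phase C U V' hf hζ (L s) (hL s V' hV')
  exact ⟨V'', h''.trans h⟩

end

section

variable {H : Type v} {K : Type w}
  [NormedAddCommGroup H] [InnerProductSpace ℂ H] [FiniteDimensional ℂ H]
  [NormedAddCommGroup K] [InnerProductSpace ℂ K]

/-- The second-order expansion, in the angle, of the trace along the rotation of `V w` towards
`m`. -/
theorem norm_trace_increment_sub_le (C : H →L[ℂ] H) {U : K →L[ℂ] K} (hU : ∀ x, ‖U x‖ = ‖x‖)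
    (V : H →ₗᵢ[ℂ] K) {w : H} {m : K} (hw : ‖w‖ = 1) (hm : ‖m‖ = 1)
    {σ : ℝ} (hσ : 0 ≤ σ) (hσ1 : σ ≤ 1) {z : K}
    (hz : z = ((√(1 - σ ^ 2) : ℝ) - 1 : ℂ) • V w + (σ : ℂ) • m) :
    ‖inner ℂ (V (adjoint C w)) (U z) + inner ℂ z (U (V (C w)))
        + inner ℂ z (U z) * inner ℂ w (C w)
      - σ * (inner ℂ (V (adjoint C w)) (U m) + inner ℂ m (U (V (C w))))
      - σ ^ 2 * (inner ℂ m (U m) * inner ℂ w (C w)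
        - (inner ℂ (V (adjoint C w)) (U (V w)) + inner ℂ (V w) (U (V (C w)))) / 2)‖
      ≤ 4 * ‖C‖ * σ ^ 3 := by
  have h1 : σ ^ 2 ≤ 1 := by nlinarith
  obtain ⟨κ, hκ⟩ : ∃ κ : ℝ, κ = 1 - √(1 - σ ^ 2) := ⟨_, rfl⟩
  have hs0 := Real.sqrt_nonneg (1 - σ ^ 2)
  have hs2 := Real.sq_sqrt (show 0 ≤ 1 - σ ^ 2 by linarith)
  have hs1 : √(1 - σ ^ 2) ≤ 1 := Real.sqrt_le_one.2 (by nlinarith)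
  have hκe : κ ^ 2 - 2 * κ + σ ^ 2 = 0 := by rw [hκ]; nlinarith
  have hκ0 : 0 ≤ κ := by linarith
  have hκ1 : κ ≤ 1 := by linarith
  have hκ2 : κ ≤ σ ^ 2 := by nlinarith
  have hκ3 : |κ - σ ^ 2 / 2| ≤ σ ^ 4 / 2 := by
    rw [abs_of_nonneg (by nlinarith)]; nlinarith
  have hz' : z = (-(κ : ℂ)) • V w + (σ : ℂ) • m := by
    rw [hz, hκ]; push_cast; rw [neg_sub]
  have hCw : ‖C w‖ ≤ ‖C‖ := by simpa [hw] using C.le_opNorm w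
  have hCaw : ‖adjoint C w‖ ≤ ‖C‖ := by
    have := (adjoint C).le_opNorm w
    rwa [hw, mul_one, LinearIsometryEquiv.norm_map] at this
  have hγ : ‖inner ℂ w (C w)‖ ≤ ‖C‖ := by
    refine (norm_inner_le_norm _ _).trans ?_
    rwa [hw, one_mul]
  have hP : ‖inner ℂ (V (adjoint C w)) (U (V w)) + inner ℂ (V w) (U (V (C w)))‖ ≤ 2 * ‖C‖ := by
    refine (norm_add_le _ _).trans ?_
    have h2 := norm_inner_apply_le_of_isometry hU (V (adjoint C w)) (V w)
    have h3 := norm_inner_apply_le_of_isometry hU (V w) (V (C w))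
    simp only [LinearIsometry.norm_map, hw, one_mul, mul_one] at h2 h3
    linarith
  have hQ : ‖inner ℂ m (U (V w)) + inner ℂ (V w) (U m)‖ ≤ 2 := by
    refine (norm_add_le _ _).trans ?_
    have h2 := norm_inner_apply_le_of_isometry hU m (V w)
    have h3 := norm_inner_apply_le_of_isometry hU (V w) m
    simp only [LinearIsometry.norm_map, hw, hm, one_mul] at h2 h3
    linarith
  have hW : ‖inner ℂ (V w) (U (V w))‖ ≤ 1 := by
    have h2 := norm_inner_apply_le_of_isometry hU (V w) (V w)
    simpa only [LinearIsometry.norm_map, hw, one_mul] using h2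
  have key : inner ℂ (V (adjoint C w)) (U z) + inner ℂ z (U (V (C w)))
        + inner ℂ z (U z) * inner ℂ w (C w)
      - σ * (inner ℂ (V (adjoint C w)) (U m) + inner ℂ m (U (V (C w))))
      - σ ^ 2 * (inner ℂ m (U m) * inner ℂ w (C w)
        - (inner ℂ (V (adjoint C w)) (U (V w)) + inner ℂ (V w) (U (V (C w)))) / 2)
      = -(((κ - σ ^ 2 / 2 : ℝ) : ℂ) *
            (inner ℂ (V (adjoint C w)) (U (V w)) + inner ℂ (V w) (U (V (C w)))))
        + ((κ ^ 2 : ℝ) : ℂ) * (inner ℂ (V w) (U (V w)) * inner ℂ w (C w))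
        - ((σ * κ : ℝ) : ℂ) * ((inner ℂ m (U (V w)) + inner ℂ (V w) (U m)) * inner ℂ w (C w)) := by
    rw [hz']
    simp only [map_add, map_smul, inner_add_left, inner_add_right, inner_smul_left,
      inner_smul_right, map_neg, Complex.conj_ofReal]
    push_cast
    ring
  rw [key]
  refine (norm_sub_le _ _).trans ((add_le_add_left (norm_add_le _ _) _).trans ?_)
  rw [norm_neg, norm_mul, norm_mul, norm_mul, norm_mul, norm_mul, Complex.norm_real,
    Complex.norm_real, Complex.norm_real, Real.norm_eq_abs, Real.norm_of_nonneg (by positivity),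
    Real.norm_of_nonneg (by positivity)]
  have hC0 := norm_nonneg C
  have t1 : |κ - σ ^ 2 / 2| * ‖inner ℂ (V (adjoint C w)) (U (V w)) + inner ℂ (V w) (U (V (C w)))‖
      ≤ σ ^ 4 / 2 * (2 * ‖C‖) := by gcongr
  have t2 : κ ^ 2 * (‖inner ℂ (V w) (U (V w))‖ * ‖inner ℂ w (C w)‖) ≤ (σ ^ 2) ^ 2 * (1 * ‖C‖) := by
    gcongr
  have t3 : σ * κ * (‖inner ℂ m (U (V w)) + inner ℂ (V w) (U m)‖ * ‖inner ℂ w (C w)‖)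
      ≤ σ * σ ^ 2 * (2 * ‖C‖) := by gcongr
  have t4 : σ ^ 4 ≤ σ ^ 3 := pow_le_pow_of_le_one hσ hσ1 (by norm_num)
  nlinarith [mul_le_mul_of_nonneg_right t4 hC0]

end

/-! ### First and second variation of the trace -/

theorem norm_expansion_le {M σ d : ℝ} (hM : 1 ≤ M) (hσ : 0 ≤ σ) (hσ1 : σ ≤ 1)
    {F₁ F₂ E : ℂ} (h2 : ‖F₂‖ ≤ 2 * M) (hE : ‖E‖ ≤ 4 * M * σ ^ 3) (hd : 0 ≤ d)
    (hd0 : d ≤ M * σ ^ 2) :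
    ‖σ * F₁ + σ ^ 2 * F₂ + E - d‖ ≤ σ * ‖F₁‖ + 7 * M * σ ^ 2 := by
  have h3 : σ ^ 3 ≤ σ ^ 2 := pow_le_pow_of_le_one hσ hσ1 (by norm_num)
  calc _ ≤ ‖(σ : ℂ) * F₁ + σ ^ 2 * F₂ + E‖ + ‖(d : ℂ)‖ := norm_sub_le _ _
    _ ≤ ‖(σ : ℂ) * F₁‖ + ‖(σ : ℂ) ^ 2 * F₂‖ + ‖E‖ + ‖(d : ℂ)‖ := by
        gcongr; exact (norm_add₃_le)
    _ = σ * ‖F₁‖ + σ ^ 2 * ‖F₂‖ + ‖E‖ + d := by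
        rw [norm_mul, norm_mul, norm_pow, Complex.norm_real, Complex.norm_real,
          Real.norm_of_nonneg hσ, Real.norm_of_nonneg hd]
    _ ≤ _ := by nlinarith [mul_le_mul_of_nonneg_left h2 (sq_nonneg σ)]

theorem re_expansion_ge {σ d B : ℝ} {F₁ F₂ E : ℂ} (hE : ‖E‖ ≤ B) :
    σ * F₁.re + σ ^ 2 * F₂.re - B - d ≤ (σ * F₁ + σ ^ 2 * F₂ + E - d : ℂ).re := by
  have h := (abs_le.1 ((Complex.abs_re_le_norm E).trans hE)).1
  have e : (σ * F₁ + σ ^ 2 * F₂ + E - d : ℂ).re = σ * F₁.re + σ ^ 2 * F₂.re + E.re - d := by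
    rw [← Complex.ofReal_pow]
    simp [-Complex.ofReal_pow]
  rw [e]; linarith

/-- A step length for which a first-order gain of `δ` dominates all other terms. -/
theorem exists_step_of_first_order {M ρ δ : ℝ} (hM : 1 ≤ M) (hρ : 0 < ρ) (hδ : 0 < δ) :
    ∃ σ : ℝ, 0 < σ ∧ σ ≤ 1 ∧ 32 * M * σ ≤ ρ ∧ ∃ d₀ : ℝ, 0 < d₀ ∧ ∀ (F₁ F₂ E : ℂ) (d : ℝ),
      ‖F₁‖ ≤ 2 * M → ‖F₂‖ ≤ 2 * M → ‖E‖ ≤ 4 * M * σ ^ 3 → δ ≤ F₁.re → 0 ≤ d → d ≤ d₀ →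
      5 * ‖σ * F₁ + σ ^ 2 * F₂ + E - d‖ ^ 2 + 32 * M * σ * ‖σ * F₁ + σ ^ 2 * F₂ + E - d‖
        ≤ 2 * ρ * (σ * F₁ + σ ^ 2 * F₂ + E - d : ℂ).re := by
  let N := 693 * M ^ 2 + 14 * ρ * M
  have hN : 0 < N := by positivity
  let σ := min 1 (min (ρ / (32 * M)) (2 * ρ * δ / N))
  have hσ : 0 < σ := by positivity
  have hσ1 : σ ≤ 1 := min_le_left _ _
  have hσ2 : σ * (32 * M) ≤ ρ :=
    (le_div_iff₀ (by positivity)).1 ((min_le_right _ _).trans (min_le_left _ _))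
  have hσ3 : σ * N ≤ 2 * ρ * δ :=
    (le_div_iff₀ hN).1 ((min_le_right _ _).trans (min_le_right _ _))
  clear_value σ
  refine ⟨σ, hσ, hσ1, by linarith, M * σ ^ 2, by positivity, ?_⟩
  intro F₁ F₂ E d h1 h2 hE hre hd hd0
  have hn := norm_expansion_le (F₁ := F₁) hM hσ.le hσ1 h2 hE hd hd0
  have hr := re_expansion_ge (σ := σ) (d := d) (F₁ := F₁) (F₂ := F₂) hE
  generalize (σ * F₁ + σ ^ 2 * F₂ + E - d : ℂ) = q at hn hr ⊢
  have h3 : σ ^ 3 ≤ σ ^ 2 := pow_le_pow_of_le_one hσ.le hσ1 (by norm_num)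
  have hF2 : -(2 * M) ≤ F₂.re := (abs_le.1 ((Complex.abs_re_le_norm F₂).trans h2)).1
  have hq : ‖q‖ ≤ 9 * M * σ := by
    have : σ ^ 2 ≤ σ := by nlinarith
    nlinarith
  have hq' : σ * δ - 7 * M * σ ^ 2 ≤ q.re := by
    nlinarith [mul_le_mul_of_nonneg_left hF2 (sq_nonneg σ), mul_le_mul_of_nonneg_left hre hσ.le]
  have hb : 5 * ‖q‖ ^ 2 + 32 * M * σ * ‖q‖ ≤ 5 * (9 * M * σ) ^ 2 + 32 * M * σ * (9 * M * σ) := by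
    gcongr
  have hc : 2 * ρ * (σ * δ - 7 * M * σ ^ 2) ≤ 2 * ρ * q.re := by gcongr
  have hf : σ * (σ * N) ≤ σ * (2 * ρ * δ) := by gcongr
  simp only [N] at hf
  nlinarith

/-- A step length for which a second-order gain of `κ` dominates all other terms, when the
first-order term is real and nonnegative. -/
theorem exists_step_of_second_order {M ρ κ : ℝ} (hM : 1 ≤ M) (hρ : 0 < ρ) (hκ : 0 < κ)
    (hκM : κ ≤ 2 * M) :
    ∃ σ : ℝ, 0 < σ ∧ σ ≤ 1 ∧ 32 * M * σ ≤ ρ ∧ ∃ d₀ : ℝ, 0 < d₀ ∧ ∀ (F₁ F₂ E : ℂ) (d : ℝ),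
      ‖F₁‖ ≤ 2 * M → ‖F₂‖ ≤ 2 * M → ‖E‖ ≤ 4 * M * σ ^ 3 → F₁ = (‖F₁‖ : ℂ) → κ ≤ F₂.re →
      0 ≤ d → d ≤ d₀ →
      5 * ‖σ * F₁ + σ ^ 2 * F₂ + E - d‖ ^ 2 + 32 * M * σ * ‖σ * F₁ + σ ^ 2 * F₂ + E - d‖
        ≤ 2 * ρ * (σ * F₁ + σ ^ 2 * F₂ + E - d : ℂ).re := by
  let σ := min (min 1 (κ / (16 * M))) (min (2 * ρ / (77 * M)) (ρ * κ / (539 * M ^ 2)))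
  have hσ : 0 < σ := by positivity
  have hσ1 : σ ≤ 1 := (min_le_left _ _).trans (min_le_left _ _)
  have hσ2 : σ * (16 * M) ≤ κ :=
    (le_div_iff₀ (by positivity)).1 ((min_le_left _ _).trans (min_le_right _ _))
  have hσ3 : σ * (77 * M) ≤ 2 * ρ :=
    (le_div_iff₀ (by positivity)).1 ((min_le_right _ _).trans (min_le_left _ _))
  have hσ4 : σ * (539 * M ^ 2) ≤ ρ * κ :=
    (le_div_iff₀ (by positivity)).1 ((min_le_right _ _).trans (min_le_right _ _))
  clear_value σ
  refine ⟨σ, hσ, hσ1, by linarith, κ * σ ^ 2 / 4, by positivity, ?_⟩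
  intro F₁ F₂ E d h1 h2 hE hre hF2 hd hd0
  have hn := norm_expansion_le (F₁ := F₁) hM hσ.le hσ1 h2 hE hd (by nlinarith [sq_nonneg σ])
  have hr := re_expansion_ge (σ := σ) (d := d) (F₁ := F₁) (F₂ := F₂) hE
  generalize (σ * F₁ + σ ^ 2 * F₂ + E - d : ℂ) = q at hn hr ⊢
  have hre' : F₁.re = ‖F₁‖ := by rw [hre]; simp
  rw [hre'] at hr
  have hF := norm_nonneg F₁
  generalize ‖F₁‖ = t at *
  have hs2 := sq_nonneg σ
  have hq : ‖q‖ ≤ 9 * M * σ := by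
    have : σ ^ 2 ≤ σ := by nlinarith
    nlinarith
  have hq' : σ * t + κ * σ ^ 2 / 2 ≤ q.re := by
    have e1 := mul_le_mul_of_nonneg_left hF2 hs2
    have e2 : σ ^ 2 * (σ * (16 * M)) ≤ σ ^ 2 * κ := by gcongr
    nlinarith
  have hb : 5 * ‖q‖ ^ 2 + 32 * M * σ * ‖q‖ ≤ 77 * M * σ * (σ * t + 7 * M * σ ^ 2) := by
    calc 5 * ‖q‖ ^ 2 + 32 * M * σ * ‖q‖ = (5 * ‖q‖ + 32 * M * σ) * ‖q‖ := by ring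
      _ ≤ (5 * (9 * M * σ) + 32 * M * σ) * (σ * t + 7 * M * σ ^ 2) := by gcongr
      _ = _ := by ring
  have hc : 2 * ρ * (σ * t + κ * σ ^ 2 / 2) ≤ 2 * ρ * q.re := by gcongr
  have e3 : (σ * t) * (σ * (77 * M)) ≤ (σ * t) * (2 * ρ) := by gcongr
  have e4 : σ ^ 2 * (σ * (539 * M ^ 2)) ≤ σ ^ 2 * (ρ * κ) := by gcongr
  nlinarith

section

variable {H : Type v} [NormedAddCommGroup H] [InnerProductSpace ℂ H] [FiniteDimensional ℂ H]

theorem norm_first_variation_le (C : H →L[ℂ] H) {K : Type w} [NormedAddCommGroup K]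
    [InnerProductSpace ℂ K] {U : K →L[ℂ] K} (hU : ∀ x, ‖U x‖ = ‖x‖)
    (V : H →ₗᵢ[ℂ] K) {w : H} {m : K} (hw : ‖w‖ = 1) (hm : ‖m‖ = 1) :
    ‖inner ℂ (V (adjoint C w)) (U m) + inner ℂ m (U (V (C w)))‖ ≤ 2 * ‖C‖ := by
  have hCw : ‖C w‖ ≤ ‖C‖ := by simpa [hw] using C.le_opNorm w
  have hCaw : ‖adjoint C w‖ ≤ ‖C‖ := by
    have := (adjoint C).le_opNorm w
    rwa [hw, mul_one, LinearIsometryEquiv.norm_map] at this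
  refine (norm_add_le _ _).trans ?_
  have h2 := norm_inner_apply_le_of_isometry hU (V (adjoint C w)) m
  have h3 := norm_inner_apply_le_of_isometry hU m (V (C w))
  simp only [LinearIsometry.norm_map, hm, one_mul, mul_one] at h2 h3
  linarith

theorem norm_second_variation_le (C : H →L[ℂ] H) {K : Type w} [NormedAddCommGroup K]
    [InnerProductSpace ℂ K] {U : K →L[ℂ] K} (hU : ∀ x, ‖U x‖ = ‖x‖)
    (V : H →ₗᵢ[ℂ] K) {w : H} {m : K} (hw : ‖w‖ = 1) (hm : ‖m‖ = 1) :
    ‖inner ℂ m (U m) * inner ℂ w (C w)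
        - (inner ℂ (V (adjoint C w)) (U (V w)) + inner ℂ (V w) (U (V (C w)))) / 2‖ ≤ 2 * ‖C‖ := by
  have h1 := norm_first_variation_le C hU V (m := V w) hw (by rw [V.norm_map, hw])
  have hγ : ‖inner ℂ w (C w)‖ ≤ ‖C‖ := by
    refine (norm_inner_le_norm _ _).trans ?_
    simpa [hw] using C.le_opNorm w
  have h2 := norm_inner_apply_le_of_isometry hU m m
  rw [hm, one_mul] at h2
  refine (norm_sub_le _ _).trans ?_
  rw [norm_mul, norm_div, Complex.norm_ofNat]
  have : ‖inner ℂ m (U m)‖ * ‖inner ℂ w (C w)‖ ≤ 1 * ‖C‖ := by gcongr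
  linarith

/-- A step length `σ` suffices as soon as the domination condition of `exists_isometry_trace_eq`
holds for every third-order remainder `E` of the admissible size. -/
theorem exists_isometry_of_step (C : H →L[ℂ] H) {K : Type w} [NormedAddCommGroup K]
    [InnerProductSpace ℂ K] [CompleteSpace K] {U : K →L[ℂ] K} (hU : ∀ x, ‖U x‖ = ‖x‖)
    (V : H →ₗᵢ[ℂ] K) {e f : H} (hf : ‖f‖ = 1) (hef : inner ℂ f e = 0)
    {a r : ℝ} (hρ : 0 < a * r) (hCe : inner ℂ f (C e) = r)
    (hT : compression U V = (a : ℂ) • rankOne ℂ e f) {w : H} {m : K} (hw : ‖w‖ = 1)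
    (hm : ‖m‖ = 1) (hp : ∀ x, inner ℂ (V x) m = 0) {σ d : ℝ} (hσ : 0 ≤ σ) (hσ1 : σ ≤ 1)
    (hd : 0 ≤ d) (hη : 32 * (‖C‖ + 1) * σ ≤ a * r) {F₁ F₂ : ℂ}
    (hF₁ : F₁ = inner ℂ (V (adjoint C w)) (U m) + inner ℂ m (U (V (C w))))
    (hF₂ : F₂ = inner ℂ m (U m) * inner ℂ w (C w)
        - (inner ℂ (V (adjoint C w)) (U (V w)) + inner ℂ (V w) (U (V (C w)))) / 2)
    (h : ∀ E : ℂ, ‖E‖ ≤ 4 * (‖C‖ + 1) * σ ^ 3 →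
      5 * ‖σ * F₁ + σ ^ 2 * F₂ + E - d‖ ^ 2
          + 32 * (‖C‖ + 1) * σ * ‖σ * F₁ + σ ^ 2 * F₂ + E - d‖
        ≤ 2 * (a * r) * (σ * F₁ + σ ^ 2 * F₂ + E - d : ℂ).re) :
    ∃ V' : H →ₗᵢ[ℂ] K, opTrace H (C ∘L compression U V') = (a * r : ℝ) + d := by
  have h3 := norm_trace_increment_sub_le C hU V hw hm hσ hσ1 rfl
  rw [← hF₁, ← hF₂] at h3
  refine exists_isometry_trace_eq C hU V hf hef hρ hCe hT hw hm hp hσ hσ1 hd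
    (by nlinarith) rfl rfl ?_
  have h4 := h _ (h3.trans (by gcongr; linarith))
  have hid : ∀ x : ℂ, σ * F₁ + σ ^ 2 * F₂ + (x - σ * F₁ - σ ^ 2 * F₂) = x := fun x => by ring
  rw [hid] at h4
  refine le_trans ?_ h4
  gcongr
  linarith

/-- If the first variation of the trace has real part at least `δ`, then all values slightly
larger than `tr (C T) = a r` are attained, uniformly in the dilation. -/
theorem exists_isometry_of_first_variation (C : H →L[ℂ] H) {e f : H} (hf : ‖f‖ = 1)
    (hef : inner ℂ f e = 0) {a r : ℝ} (hρ : 0 < a * r) (hCe : inner ℂ f (C e) = r)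
    {δ : ℝ} (hδ : 0 < δ) :
    ∃ d₀ : ℝ, 0 < d₀ ∧ ∀ (K : Type u) [NormedAddCommGroup K] [InnerProductSpace ℂ K]
      [CompleteSpace K] (U : K →L[ℂ] K) (V : H →ₗᵢ[ℂ] K) (w : H) (m : K), (∀ x, ‖U x‖ = ‖x‖) →
      compression U V = (a : ℂ) • rankOne ℂ e f → ‖w‖ = 1 → ‖m‖ = 1 →
      (∀ x, inner ℂ (V x) m = 0) →
      δ ≤ (inner ℂ (V (adjoint C w)) (U m) + inner ℂ m (U (V (C w)))).re →
      ∀ d : ℝ, 0 ≤ d → d ≤ d₀ →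
      ∃ V' : H →ₗᵢ[ℂ] K, opTrace H (C ∘L compression U V') = (a * r : ℝ) + d := by
  have hM : 1 ≤ ‖C‖ + 1 := by linarith [norm_nonneg C]
  obtain ⟨σ, hσ, hσ1, hση, d₀, hd₀, h⟩ := exists_step_of_first_order hM hρ hδ
  refine ⟨d₀, hd₀, ?_⟩
  intro K _ _ _ U V w m hU hT hw hm hp hre d hd hdd
  have h1 := norm_first_variation_le C hU V hw hm
  have h2 := norm_second_variation_le C hU V hw hm
  exact exists_isometry_of_step C hU V hf hef hρ hCe hT hw hm hp hσ.le hσ1 hd hση rfl rfl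
    fun E hE => h _ _ E d (by linarith) (by linarith) hE hre hd hdd

theorem exists_phase_add_eq_norm (X Y : ℂ) :
    ∃ φ : ℂ, ‖φ‖ = 1 ∧ φ * X + conj φ * Y = (‖φ * X + conj φ * Y‖ : ℂ) := by
  -- It suffices to make the sum real; then `φ` or `-φ` works.
  suffices h : ∃ φ : ℂ, ‖φ‖ = 1 ∧ (φ * X + conj φ * Y).im = 0 by
    obtain ⟨φ, h1, h2⟩ := h
    have h3 : φ * X + conj φ * Y = ((φ * X + conj φ * Y).re : ℂ) := Complex.ext rfl (by simp [h2])
    generalize hx : (φ * X + conj φ * Y).re = x at h3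
    rcases le_total 0 x with h0 | h0
    · refine ⟨φ, h1, ?_⟩
      rw [h3, Complex.norm_real, Real.norm_of_nonneg h0]
    · refine ⟨-φ, by rwa [norm_neg], ?_⟩
      have h4 : -φ * X + conj (-φ) * Y = ((-x : ℝ) : ℂ) := by
        rw [map_neg]; push_cast; linear_combination -h3
      rw [h4, Complex.norm_real, Real.norm_of_nonneg (by linarith)]
  by_cases h0 : X - conj Y = 0
  · refine ⟨1, by simp, ?_⟩
    have := congrArg Complex.im h0
    simpa using this
  · have hn : ‖X - conj Y‖ ≠ 0 := norm_ne_zero_iff.2 h0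
    refine ⟨conj (X - conj Y) / ‖X - conj Y‖, by
      rw [norm_div, Complex.norm_conj, Complex.norm_real, norm_norm, div_self hn], ?_⟩
    have h1 : (conj (X - conj Y) / ‖X - conj Y‖ * (X - conj Y)).im = 0 := by
      have h2 : conj (X - conj Y) / ‖X - conj Y‖ * (X - conj Y) = (‖X - conj Y‖ : ℂ) := by
        rw [div_mul_eq_mul_div, Complex.conj_mul', pow_two, mul_div_assoc, div_self, mul_one]
        exact_mod_cast hn
      rw [h2]; simp
    generalize conj (X - conj Y) / ‖X - conj Y‖ = φ at h1 ⊢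
    simp only [Complex.mul_im, Complex.sub_im, Complex.sub_re, Complex.conj_im, Complex.conj_re,
      Complex.add_im] at h1 ⊢
    linarith

/-- If the second variation of the trace has real part at least `κ`, then all values slightly
larger than `tr (C T) = a r` are attained, uniformly in the dilation. Nothing is assumed about the
first variation: a phase of `m`, which does not influence the second variation, makes it real and
nonnegative. -/
theorem exists_isometry_of_second_variation (C : H →L[ℂ] H) {e f : H} (hf : ‖f‖ = 1)
    (hef : inner ℂ f e = 0) {a r : ℝ} (hρ : 0 < a * r) (hCe : inner ℂ f (C e) = r)
    {κ : ℝ} (hκ : 0 < κ) :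
    ∃ d₀ : ℝ, 0 < d₀ ∧ ∀ (K : Type u) [NormedAddCommGroup K] [InnerProductSpace ℂ K]
      [CompleteSpace K] (U : K →L[ℂ] K) (V : H →ₗᵢ[ℂ] K) (w : H) (m : K), (∀ x, ‖U x‖ = ‖x‖) →
      compression U V = (a : ℂ) • rankOne ℂ e f → ‖w‖ = 1 → ‖m‖ = 1 →
      (∀ x, inner ℂ (V x) m = 0) →
      κ ≤ (inner ℂ m (U m) * inner ℂ w (C w)
        - (inner ℂ (V (adjoint C w)) (U (V w)) + inner ℂ (V w) (U (V (C w)))) / 2).re →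
      ∀ d : ℝ, 0 ≤ d → d ≤ d₀ →
      ∃ V' : H →ₗᵢ[ℂ] K, opTrace H (C ∘L compression U V') = (a * r : ℝ) + d := by
  have hM : 1 ≤ ‖C‖ + 1 := by linarith [norm_nonneg C]
  obtain ⟨σ, hσ, hσ1, hση, d₀, hd₀, h⟩ := exists_step_of_second_order hM hρ
    (lt_min hκ (show 0 < 2 * (‖C‖ + 1) by linarith)) (min_le_right _ _)
  refine ⟨d₀, hd₀, ?_⟩
  intro K _ _ _ U V w m hU hT hw hm hp hre d hd hdd
  obtain ⟨φ, hφ, hφF⟩ := exists_phase_add_eq_norm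
    (inner ℂ (V (adjoint C w)) (U m)) (inner ℂ m (U (V (C w))))
  have hφφ : conj φ * φ = 1 := by rw [Complex.conj_mul', hφ]; simp
  have hm' : ‖φ • m‖ = 1 := by rw [norm_smul, hφ, hm, one_mul]
  have hp' : ∀ x, inner ℂ (V x) (φ • m) = 0 := fun x => by rw [inner_smul_right, hp, mul_zero]
  have e1 : inner ℂ (V (adjoint C w)) (U (φ • m)) + inner ℂ (φ • m) (U (V (C w)))
      = φ * inner ℂ (V (adjoint C w)) (U m) + conj φ * inner ℂ m (U (V (C w))) := by
    rw [map_smul, inner_smul_left, inner_smul_right]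
  have e2 : inner ℂ (φ • m) (U (φ • m)) = inner ℂ m (U m) := by
    rw [map_smul, inner_smul_left, inner_smul_right, ← mul_assoc, hφφ, one_mul]
  have h1 := norm_first_variation_le C hU V hw hm'
  have h2 := norm_second_variation_le C hU V hw hm'
  refine exists_isometry_of_step C hU V hf hef hρ hCe hT hw hm' hp' hσ.le hσ1 hd hση rfl rfl
    fun E hE => h _ _ E d (by linarith) (by linarith) hE ?_ ?_ hd hdd
  · rw [e1]; exact hφF
  · rw [e2]; exact (min_le_left _ _).trans hre

end

/-! ### The gradient of the trace -/

section

variable {H : Type v} {K : Type w}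
  [NormedAddCommGroup H] [InnerProductSpace ℂ H] [FiniteDimensional ℂ H]
  [NormedAddCommGroup K] [InnerProductSpace ℂ K] [CompleteSpace K]

/-- The component of `U V x` orthogonal to the range of the isometry `V`. -/
noncomputable def defectVector (U : K →L[ℂ] K) (V : H →ₗᵢ[ℂ] K) : H →ₗ[ℂ] K :=
  (U.toLinearMap ∘ₗ V.toLinearMap) - V.toLinearMap ∘ₗ (compression U V).toLinearMap

theorem defectVector_apply (U : K →L[ℂ] K) (V : H →ₗᵢ[ℂ] K) (x : H) :
    defectVector U V x = U (V x) - V (compression U V x) := rfl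

theorem inner_defectVector (U : K →L[ℂ] K) (V : H →ₗᵢ[ℂ] K) (x y : H) :
    inner ℂ (V y) (defectVector U V x) = 0 := by
  rw [defectVector_apply, inner_sub_right, V.inner_map_map, inner_compression, sub_self]

theorem inner_defectVector' (U : K →L[ℂ] K) (V : H →ₗᵢ[ℂ] K) (x y : H) :
    inner ℂ (defectVector U V x) (V y) = 0 := by
  rw [← inner_conj_symm, inner_defectVector, map_zero]

theorem inner_defectVector_defectVector {U : K →L[ℂ] K}
    (hU : ∀ x y, inner ℂ (U x) (U y) = inner ℂ x y)
    (V : H →ₗᵢ[ℂ] K) (x y : H) :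
    inner ℂ (defectVector U V x) (defectVector U V y) =
      inner ℂ x y - inner ℂ (compression U V x) (compression U V y) := by
  conv_lhs => rw [defectVector_apply U V y, inner_sub_right, inner_defectVector', sub_zero,
    defectVector_apply, inner_sub_left, hU, V.inner_map_map, ← inner_compression]

theorem norm_sq_defectVector {U : K →L[ℂ] K} (hU : ∀ x y, inner ℂ (U x) (U y) = inner ℂ x y)
    (V : H →ₗᵢ[ℂ] K) (x : H) :
    ‖defectVector U V x‖ ^ 2 = ‖x‖ ^ 2 - ‖compression U V x‖ ^ 2 := by
  have h := inner_defectVector_defectVector hU V x x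
  simp only [inner_self_eq_norm_sq_to_K] at h
  exact_mod_cast h

theorem compression_adjoint (U : K →L[ℂ] K) (V : H →ₗᵢ[ℂ] K) :
    compression (adjoint U) V = adjoint (compression U V) := by
  simp [compression, adjoint_comp, ContinuousLinearMap.comp_assoc]

/-- The gradient, in the direction of changing `V w` by vectors orthogonal to the range of `V`, of
the real part of `tr (C V* U V)`. -/
noncomputable def traceGradient (C : H →L[ℂ] H) (U : K →L[ℂ] K) (V : H →ₗᵢ[ℂ] K) : H →ₗ[ℂ] K :=
  defectVector (adjoint U) V ∘ₗ (adjoint C).toLinearMap + defectVector U V ∘ₗ C.toLinearMap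

theorem traceGradient_apply (C : H →L[ℂ] H) (U : K →L[ℂ] K) (V : H →ₗᵢ[ℂ] K) (w : H) :
    traceGradient C U V w = defectVector (adjoint U) V (adjoint C w) + defectVector U V (C w) := rfl

theorem inner_traceGradient (C : H →L[ℂ] H) (U : K →L[ℂ] K) (V : H →ₗᵢ[ℂ] K) (x w : H) :
    inner ℂ (V x) (traceGradient C U V w) = 0 := by
  rw [traceGradient_apply, inner_add_right, inner_defectVector, inner_defectVector, add_zero]

theorem re_first_variation (C : H →L[ℂ] H) (U : K →L[ℂ] K) (V : H →ₗᵢ[ℂ] K) (w : H) {m : K}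
    (hp : ∀ x, inner ℂ (V x) m = 0) :
    (inner ℂ (V (adjoint C w)) (U m) + inner ℂ m (U (V (C w)))).re
      = (inner ℂ m (traceGradient C U V w)).re := by
  have hp' : ∀ x, inner ℂ m (V x) = 0 := fun x => by rw [← inner_conj_symm, hp]; simp
  rw [traceGradient_apply, defectVector_apply, defectVector_apply, inner_add_right,
    inner_sub_right, inner_sub_right, hp', hp', sub_zero, sub_zero, Complex.add_re, Complex.add_re,
    ← inner_conj_symm m (adjoint U _), adjoint_inner_left, Complex.conj_re]

theorem adjoint_mem_unitary {U : K →L[ℂ] K} (hU : U ∈ unitary (K →L[ℂ] K)) :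
    adjoint U ∈ unitary (K →L[ℂ] K) := Unitary.star_mem hU

theorem apply_adjoint_of_mem_unitary {U : K →L[ℂ] K} (hU : U ∈ unitary (K →L[ℂ] K)) (x : K) :
    U (adjoint U x) = x := by
  have : U ∘L adjoint U = 1 := (Unitary.mem_iff.1 hU).2
  rw [← ContinuousLinearMap.comp_apply, this]; rfl

end

section

variable {H : Type v} [NormedAddCommGroup H] [InnerProductSpace ℂ H] [FiniteDimensional ℂ H]

/-- `ExceedsOnDilations C T r`: for some `d₀ > 0`, all the numbers `r + d` with `0 ≤ d ≤ d₀` have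
the form `tr (C Y)` with `Y` a compression of `U`, for every unitary dilation `U` of `T`. -/
def ExceedsOnDilations (C T : H →L[ℂ] H) (r : ℝ) : Prop :=
  ∃ d₀ : ℝ, 0 < d₀ ∧ ∀ (K : Type u) [NormedAddCommGroup K] [InnerProductSpace ℂ K]
    [CompleteSpace K] (U : K →L[ℂ] K) (V : H →ₗᵢ[ℂ] K), U ∈ unitary (K →L[ℂ] K) →
    compression U V = T → ∀ d : ℝ, 0 ≤ d → d ≤ d₀ →
    ∃ V' : H →ₗᵢ[ℂ] K, opTrace H (C ∘L compression U V') = (r : ℂ) + d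

/-- A gradient that is bounded below produces values beyond `a r`. -/
theorem exists_isometry_of_traceGradient (C : H →L[ℂ] H) {e f : H} (hf : ‖f‖ = 1)
    (hef : inner ℂ f e = 0) {a r : ℝ} (hρ : 0 < a * r) (hCe : inner ℂ f (C e) = r)
    {δ : ℝ} (hδ : 0 < δ) (v : H) :
    ∃ d₀ : ℝ, 0 < d₀ ∧ ∀ (K : Type u) [NormedAddCommGroup K] [InnerProductSpace ℂ K]
      [CompleteSpace K] (U : K →L[ℂ] K) (V : H →ₗᵢ[ℂ] K), U ∈ unitary (K →L[ℂ] K) →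
      compression U V = (a : ℂ) • rankOne ℂ e f → δ ≤ ‖traceGradient C U V v‖ →
      ∀ d : ℝ, 0 ≤ d → d ≤ d₀ →
      ∃ V' : H →ₗᵢ[ℂ] K, opTrace H (C ∘L compression U V') = ((a * r : ℝ) : ℂ) + d := by
  obtain ⟨d₀, hd₀, h⟩ := exists_isometry_of_first_variation.{u} C hf hef hρ hCe
    (show 0 < δ / (‖v‖ + 1) by positivity)
  refine ⟨d₀, hd₀, fun K _ _ _ U V hU hT hG => ?_⟩
  have hG0 : 0 < ‖traceGradient C U V v‖ := hδ.trans_le hG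
  have hv : 0 < ‖v‖ := by
    rw [norm_pos_iff]; rintro rfl; simp at hG0
  set G := traceGradient C U V v with hGd
  have hw : ‖((‖v‖⁻¹ : ℝ) : ℂ) • v‖ = 1 := by
    rw [norm_smul, Complex.norm_real, norm_inv, norm_norm, inv_mul_cancel₀ hv.ne']
  have hm : ‖((‖G‖⁻¹ : ℝ) : ℂ) • G‖ = 1 := by
    rw [norm_smul, Complex.norm_real, norm_inv, norm_norm, inv_mul_cancel₀ hG0.ne']
  have hp : ∀ x, inner ℂ (V x) (((‖G‖⁻¹ : ℝ) : ℂ) • G) = 0 := fun x => by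
    rw [inner_smul_right, inner_traceGradient, mul_zero]
  refine h K U V _ _ (norm_map_of_mem_unitary hU) hT hw hm hp ?_
  rw [re_first_variation C U V _ hp, map_smul, ← hGd, inner_smul_left, inner_smul_right,
    Complex.conj_ofReal, inner_self_eq_norm_sq_to_K]
  have e : ((‖G‖⁻¹ : ℝ) : ℂ) * (((‖v‖⁻¹ : ℝ) : ℂ) * ((‖G‖ : ℂ) ^ 2)) = ((‖G‖ / ‖v‖ : ℝ) : ℂ) := by
    have : (‖G‖ : ℂ) ≠ 0 := by exact_mod_cast hG0.ne'
    push_cast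
    field_simp
  refine le_trans ?_ (congrArg Complex.re e).ge
  rw [Complex.ofReal_re]
  gcongr
  linarith

theorem adjoint_smul_rankOne (a : ℝ) (e f : H) :
    adjoint ((a : ℂ) • rankOne ℂ e f) = (a : ℂ) • rankOne ℂ f e := by
  rw [map_smulₛₗ, adjoint_rankOne, Complex.conj_ofReal]

/-- The gradient can only vanish if `C (1 - T T*) C* = C* (1 - T* T) C`. -/
theorem exceedsOnDilations_of_norm_sq_ne (C : H →L[ℂ] H) {e f : H} (hf : ‖f‖ = 1)
    (hef : inner ℂ f e = 0) {a r : ℝ} (hρ : 0 < a * r) (hCe : inner ℂ f (C e) = r) {w : H}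
    (hw : ‖adjoint C w‖ ^ 2 - ‖(a : ℂ) • rankOne ℂ f e (adjoint C w)‖ ^ 2 ≠
      ‖C w‖ ^ 2 - ‖(a : ℂ) • rankOne ℂ e f (C w)‖ ^ 2) :
    ExceedsOnDilations.{u} C ((a : ℂ) • rankOne ℂ e f) (a * r) := by
  set γ := |(‖adjoint C w‖ ^ 2 - ‖(a : ℂ) • rankOne ℂ f e (adjoint C w)‖ ^ 2) -
      (‖C w‖ ^ 2 - ‖(a : ℂ) • rankOne ℂ e f (C w)‖ ^ 2)| with hγ
  have hγ0 : 0 < γ := abs_pos.2 (sub_ne_zero.2 hw)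
  set B := ‖adjoint C w‖ + ‖C w‖ + 1 with hB
  have hB0 : 0 < B := by positivity
  obtain ⟨d₀, hd₀, h⟩ := exists_isometry_of_traceGradient.{u} C hf hef hρ hCe
    (show 0 < γ / B by positivity) w
  refine ⟨d₀, hd₀, fun K _ _ _ U V hU hT => h K U V hU hT ?_⟩
  rw [div_le_iff₀ hB0]
  have h1 := norm_sq_defectVector (inner_map_map_of_mem_unitary (adjoint_mem_unitary hU)) V
    (adjoint C w)
  have h2 := norm_sq_defectVector (inner_map_map_of_mem_unitary hU) V (C w)
  rw [compression_adjoint, hT, adjoint_smul_rankOne] at h1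
  rw [hT] at h2
  simp only [smul_apply] at h1 h2
  rw [← h1, ← h2] at hγ
  have h3 : ‖defectVector (adjoint U) V (adjoint C w)‖ ≤ ‖adjoint C w‖ :=
    abs_le_of_sq_le_sq' (by rw [h1]; linarith [sq_nonneg ‖(a : ℂ) • rankOne ℂ f e (adjoint C w)‖])
      (norm_nonneg _) |>.2
  have h4 : ‖defectVector U V (C w)‖ ≤ ‖C w‖ :=
    abs_le_of_sq_le_sq' (by rw [h2]; linarith [sq_nonneg ‖(a : ℂ) • rankOne ℂ e f (C w)‖])
      (norm_nonneg _) |>.2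
  have h5 : |‖defectVector (adjoint U) V (adjoint C w)‖ - ‖defectVector U V (C w)‖|
      ≤ ‖traceGradient C U V w‖ := by
    have := abs_norm_sub_norm_le (defectVector (adjoint U) V (adjoint C w))
      (-(defectVector U V (C w)))
    rwa [norm_neg, sub_neg_eq_add] at this
  rw [hγ, sq_sub_sq, abs_mul, mul_comm, abs_of_nonneg (a := _ + _) (by positivity)]
  gcongr
  linarith

end

/-! ### The second-order criterion -/

section

variable {H : Type v} [NormedAddCommGroup H] [InnerProductSpace ℂ H] [FiniteDimensional ℂ H]

/-- The quadratic form of `U` at a backward defect vector `U* V x - V T* x` with `x = C* v`. Up to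
an error controlled by the gradient, it does not depend on the dilation `U`. -/
theorem inner_defectVector_adjoint_apply (C : H →L[ℂ] H) {K : Type w} [NormedAddCommGroup K]
    [InnerProductSpace ℂ K] [CompleteSpace K] {U : K →L[ℂ] K} (hU : U ∈ unitary (K →L[ℂ] K))
    (V : H →ₗᵢ[ℂ] K) {e f : H} (he : ‖e‖ = 1) (hf : ‖f‖ = 1) {a : ℝ}
    (hT : compression U V = (a : ℂ) • rankOne ℂ e f) {ω : ℂ}
    (hω : adjoint C f = conj ω • C e) (v : H) :
    inner ℂ (defectVector (adjoint U) V (adjoint C v))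
        (U (defectVector (adjoint U) V (adjoint C v)))
      = a * (1 - a ^ 2) * conj ω * ‖inner ℂ e (adjoint C v)‖ ^ 2
        - a * inner ℂ e (adjoint C v)
          * inner ℂ (traceGradient C U V v) (defectVector U V f) := by
  have hff : inner ℂ f f = (1 : ℂ) := by rw [inner_self_eq_norm_sq_to_K, hf]; simp
  have hee : inner ℂ e e = (1 : ℂ) := by rw [inner_self_eq_norm_sq_to_K, he]; simp
  have hUU : ∀ x, U (adjoint U x) = x := apply_adjoint_of_mem_unitary hU
  have hUx : U (defectVector (adjoint U) V (adjoint C v)) = V (adjoint C v)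
      - (a * inner ℂ e (adjoint C v) : ℂ) • (V (compression U V f) + defectVector U V f) := by
    have h1 : V (compression U V f) + defectVector U V f = U (V f) := by
      rw [defectVector_apply]; abel
    rw [h1, defectVector_apply, map_sub, hUU, compression_adjoint, hT, adjoint_smul_rankOne,
      smul_apply, rankOne_apply, smul_smul, map_smul, map_smul]
  rw [hUx, inner_sub_right, inner_smul_right, inner_add_right, inner_defectVector',
    inner_defectVector', zero_add]
  have h2 : defectVector (adjoint U) V (adjoint C v)
      = traceGradient C U V v - defectVector U V (C v) := by
    rw [traceGradient_apply]; abel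
  rw [h2, inner_sub_left, inner_defectVector_defectVector (inner_map_map_of_mem_unitary hU) V,
    hT]
  have h3 : inner ℂ (C v) f = conj ω * inner ℂ (adjoint C v) e := by
    rw [← adjoint_inner_right, hω, inner_smul_right, ← adjoint_inner_left]
  simp only [smul_apply, rankOne_apply, inner_smul_left, inner_smul_right, hff, hee,
    Complex.conj_ofReal, inner_conj_symm]
  rw [h3, ← Complex.mul_conj', inner_conj_symm]
  ring

theorem re_second_order_term (C : H →L[ℂ] H) {e f : H} {a r : ℝ} {ω : ℂ} (hω1 : ‖ω‖ = 1)
    (hCe : C e = (r : ℂ) • (ω • e + f)) (hω : adjoint C f = conj ω • C e) (w : H) :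
    (inner ℂ (adjoint C w) (((a : ℂ) • rankOne ℂ e f : H →L[ℂ] H) w)
      + inner ℂ w (((a : ℂ) • rankOne ℂ e f : H →L[ℂ] H) (C w))).re
      = a * r * ‖inner ℂ w (ω • e + f)‖ ^ 2 := by
  have hωω : conj ω * ω = 1 := by rw [Complex.conj_mul', hω1]; simp
  have h1 : inner ℂ f (C w) = ω * (r * (conj ω * inner ℂ e w + inner ℂ f w)) := by
    rw [← adjoint_inner_left, hω, hCe, inner_smul_left, inner_smul_left, inner_add_left,
      inner_smul_left, Complex.conj_conj, Complex.conj_ofReal]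
  have h2 : inner ℂ (adjoint C w) e = r * (ω * inner ℂ w e + inner ℂ w f) := by
    rw [adjoint_inner_left, hCe, inner_smul_right, inner_add_right, inner_smul_right]
  simp only [smul_apply, rankOne_apply, inner_smul_right, h1, h2, inner_add_right]
  rw [← inner_conj_symm e w, ← inner_conj_symm f w]
  generalize inner ℂ w e = p
  generalize inner ℂ w f = q
  have h3 : (a : ℂ) * (conj q * (r * (ω * p + q)))
      + a * (ω * (r * (conj ω * conj p + conj q)) * p)
      = ((a * r : ℝ) : ℂ) * (conj p * p + conj q * q + 2 * (ω * p * conj q)) := by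
    push_cast
    linear_combination (a * r * conj p * p) * hωω
  have h4 : ‖ω * p + q‖ ^ 2 = (conj p * p + conj q * q + 2 * (ω * p * conj q)).re := by
    have h5 : ((‖ω * p + q‖ ^ 2 : ℝ) : ℂ)
        = conj p * p + conj q * q + (ω * p * conj q + conj (ω * p * conj q)) := by
      push_cast
      rw [← Complex.conj_mul']
      simp only [map_add, map_mul, Complex.conj_conj]
      linear_combination (conj p * p) * hωω
    rw [← Complex.ofReal_re (‖ω * p + q‖ ^ 2), h5, Complex.add_conj]
    simp
  rw [h3, h4, Complex.re_ofReal_mul]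

set_option maxHeartbeats 800000 in
/-- The second-order criterion, for matrices satisfying `C e = r (ω e + f) = ω C* f`. -/
theorem exceedsOnDilations_of_second_order (C : H →L[ℂ] H) {e f : H} (he : ‖e‖ = 1)
    (hf : ‖f‖ = 1) (hef : inner ℂ f e = 0) {a r : ℝ} (ha : 0 < a) (ha1 : a < 1) (hr : 0 < r)
    {ω : ℂ} (hω1 : ‖ω‖ = 1)
    (hCe : C e = (r : ℂ) • (ω • e + f)) (hω : adjoint C f = conj ω • C e) {v w : H} (hw : ‖w‖ = 1)
    (h : ‖adjoint C v‖ ^ 2 * (r / 2 * ‖inner ℂ w (ω • e + f)‖ ^ 2)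
      < (1 - a ^ 2) * ‖inner ℂ e (adjoint C v)‖ ^ 2 * (conj ω * inner ℂ w (C w)).re) :
    ExceedsOnDilations.{u} C ((a : ℂ) • rankOne ℂ e f) (a * r) := by
  have hff : inner ℂ f f = (1 : ℂ) := by rw [inner_self_eq_norm_sq_to_K, hf]; simp
  have hfCe : inner ℂ f (C e) = r := by
    rw [hCe, inner_smul_right, inner_add_right, inner_smul_right, hef, hff]; simp
  have hρ : 0 < a * r := mul_pos ha hr
  set x := adjoint C v with hx
  set Q := r / 2 * ‖inner ℂ w (ω • e + f)‖ ^ 2 with hQ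
  set R := (conj ω * inner ℂ w (C w)).re with hR
  set t := ‖inner ℂ e x‖ with ht
  have hQ0 : 0 ≤ Q := by positivity
  have ha2 : 0 < 1 - a ^ 2 := by nlinarith
  have hpos : 0 < (1 - a ^ 2) * t ^ 2 * R := lt_of_le_of_lt (by positivity) h
  have ht0 : t ≠ 0 := by rintro h0; simp [h0] at hpos
  have htx : t ≤ ‖x‖ := by simpa [he] using norm_inner_le_norm (𝕜 := ℂ) e x
  have hR0 : 0 < R := by
    by_contra h0
    have : (1 - a ^ 2) * t ^ 2 * R ≤ 0 := mul_nonpos_of_nonneg_of_nonpos (by positivity) (not_lt.1 h0)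
    linarith
  -- the square of the norm of the backward defect vector at `x`
  set N := ‖x‖ ^ 2 - a ^ 2 * t ^ 2 with hN
  have ht2 : 0 < t ^ 2 := by positivity
  have htx2 : t ^ 2 ≤ ‖x‖ ^ 2 := by gcongr
  have hN0 : 0 < N := by nlinarith
  have hNx : N ≤ ‖x‖ ^ 2 := by nlinarith [sq_nonneg (a * t)]
  set κ := a * ((1 - a ^ 2) * t ^ 2 * R / N - Q) with hκ
  have hκ0 : 0 < κ := by
    refine mul_pos ha (sub_pos.2 ?_)
    rw [lt_div_iff₀ hN0]
    nlinarith
  set B := a * t * ‖inner ℂ w (C w)‖ / N with hB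
  have hB0 : 0 ≤ B := by positivity
  have hBκ : B * (κ / (2 * (B + 1))) ≤ κ / 2 := by
    rw [mul_div_assoc', div_le_div_iff₀ (by positivity) (by norm_num)]
    nlinarith
  have haN : 0 ≤ a / N := by positivity
  clear_value κ B N R Q t
  obtain ⟨d₁, hd₁, h1⟩ := exists_isometry_of_traceGradient.{u} C hf hef hρ hfCe
    (show 0 < κ / (2 * (B + 1)) by positivity) v
  obtain ⟨d₂, hd₂, h2⟩ := exists_isometry_of_second_variation.{u} C hf hef hρ hfCe
    (show 0 < κ / 2 by positivity)
  refine ⟨min d₁ d₂, lt_min hd₁ hd₂, fun K _ _ _ U V hU hT d hd hdd => ?_⟩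
  rcases le_total (κ / (2 * (B + 1))) ‖traceGradient C U V v‖ with hG | hG
  · exact h1 K U V hU hT hG d hd (hdd.trans (min_le_left _ _))
  set α := defectVector (adjoint U) V x with hα
  have hαN : ‖α‖ ^ 2 = N := by
    have := norm_sq_defectVector (inner_map_map_of_mem_unitary (adjoint_mem_unitary hU)) V x
    rw [this, compression_adjoint, hT, adjoint_smul_rankOne, smul_apply, rankOne_apply, norm_smul,
      norm_smul, hf, Complex.norm_real, Real.norm_of_nonneg ha.le, hN, ht]
    ring
  have hα0 : 0 < ‖α‖ := by
    rcases (norm_nonneg α).lt_or_eq with h0 | h0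
    · exact h0
    · rw [← h0] at hαN; simp at hαN; linarith
  have hm : ‖((‖α‖⁻¹ : ℝ) : ℂ) • α‖ = 1 := by
    rw [norm_smul, Complex.norm_real, norm_inv, norm_norm, inv_mul_cancel₀ hα0.ne']
  refine h2 K U V w (((‖α‖⁻¹ : ℝ) : ℂ) • α) (norm_map_of_mem_unitary hU) hT hw hm
    (fun y => by rw [inner_smul_right, inner_defectVector, mul_zero]) ?_ d hd
    (hdd.trans (min_le_right _ _))
  have e1 : inner ℂ (((‖α‖⁻¹ : ℝ) : ℂ) • α) (U (((‖α‖⁻¹ : ℝ) : ℂ) • α))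
      = ((N⁻¹ : ℝ) : ℂ) * inner ℂ α (U α) := by
    rw [map_smul, inner_smul_left, inner_smul_right, Complex.conj_ofReal, ← hαN, ← mul_assoc,
      ← Complex.ofReal_mul]
    congr 2
    rw [pow_two, mul_inv]
  have e2 := inner_defectVector_adjoint_apply C hU V he hf hT hω v
  have e3 := re_second_order_term C (a := a) hω1 hCe hω w
  rw [← hT, inner_compression, inner_compression] at e3
  set β := inner ℂ (traceGradient C U V v) (defectVector U V f) with hβ
  have hβn : ‖β‖ ≤ ‖traceGradient C U V v‖ := by
    have h3 := norm_sq_defectVector (inner_map_map_of_mem_unitary hU) V f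
    have h4 : ‖defectVector U V f‖ ≤ 1 := by
      refine abs_le_of_sq_le_sq' ?_ zero_le_one |>.2
      rw [h3, hf]; nlinarith [sq_nonneg ‖compression U V f‖]
    exact (norm_inner_le_norm _ _).trans (mul_le_of_le_one_right (norm_nonneg _) h4)
  rw [e1, e2, Complex.sub_re]
  have e4 : ((N⁻¹ : ℝ) : ℂ) * (a * (1 - a ^ 2) * conj ω * (t : ℂ) ^ 2 - a * inner ℂ e x * β)
        * inner ℂ w (C w)
      = ((a * (1 - a ^ 2) * t ^ 2 / N : ℝ) : ℂ) * (conj ω * inner ℂ w (C w))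
        - ((a / N : ℝ) : ℂ) * inner ℂ e x * inner ℂ w (C w) * β := by
    push_cast; ring
  have e5 : ‖((a / N : ℝ) : ℂ) * inner ℂ e x * inner ℂ w (C w) * β‖ ≤ κ / 2 := by
    rw [norm_mul, norm_mul, norm_mul, Complex.norm_real, Real.norm_of_nonneg haN, ← ht]
    calc a / N * t * ‖inner ℂ w (C w)‖ * ‖β‖ = B * ‖β‖ := by rw [hB]; ring
      _ ≤ B * (κ / (2 * (B + 1))) := 
        mul_le_mul_of_nonneg_left (hβn.trans hG) hB0
      _ ≤ κ / 2 := hBκ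
  have e6 := (abs_le.1 ((Complex.abs_re_le_norm _).trans e5)).2
  rw [← ht, e4, Complex.sub_re, Complex.re_ofReal_mul, ← hR]
  have e7 : ((inner ℂ (V (adjoint C w)) (U (V w)) + inner ℂ (V w) (U (V (C w)))) / 2).re
      = a * Q := by
    rw [Complex.div_ofNat_re, e3, hQ]; ring
  rw [e7]
  have e8 : κ = a * (1 - a ^ 2) * t ^ 2 / N * R - a * Q := by rw [hκ]; ring
  linarith

end

/-! ### Extremal orthonormal pairs -/

section

variable {H : Type v} [NormedAddCommGroup H] [InnerProductSpace ℂ H]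

/-- An orthonormal pair `(e, f)` on which `|⟨f, C e⟩|` attains its maximum `r` over orthonormal
pairs; the phase of `f` is chosen to make the value real. -/
structure IsExtremalPair (C : H →L[ℂ] H) (e f : H) (r : ℝ) : Prop where
  norm_left : ‖e‖ = 1
  norm_right : ‖f‖ = 1
  inner_eq_zero : inner ℂ f e = 0
  nonneg : 0 ≤ r
  inner_apply : inner ℂ f (C e) = r
  le : ∀ x y : H, inner ℂ y x = 0 → ‖inner ℂ y (C x)‖ ≤ r * (‖y‖ * ‖x‖)

namespace IsExtremalPair

variable {C : H →L[ℂ] H} {e f : H} {r : ℝ}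

theorem inner_self_left (h : IsExtremalPair C e f r) : inner ℂ e e = (1 : ℂ) := by
  rw [inner_self_eq_norm_sq_to_K, h.norm_left]; simp

theorem inner_self_right (h : IsExtremalPair C e f r) : inner ℂ f f = (1 : ℂ) := by
  rw [inner_self_eq_norm_sq_to_K, h.norm_right]; simp

theorem inner_eq_zero' (h : IsExtremalPair C e f r) : inner ℂ e f = 0 := by
  rw [← inner_conj_symm, h.inner_eq_zero, map_zero]

/-- First-order optimality: the off-diagonal part of `C e` points in the direction of `f`. -/
theorem apply_eq (h : IsExtremalPair C e f r) :
    C e = inner ℂ e (C e) • e + (r : ℂ) • f := by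
  set g := C e - inner ℂ e (C e) • e with hg
  have h1 : inner ℂ g e = 0 := by
    rw [← inner_conj_symm, hg, inner_sub_right, inner_smul_right, h.inner_self_left, mul_one,
      sub_self, map_zero]
  have h2 : inner ℂ g (C e) = (‖g‖ ^ 2 : ℂ) := by
    have : C e = g + inner ℂ e (C e) • e := by rw [hg]; abel
    rw [this, inner_add_right, inner_smul_right, h1, mul_zero, add_zero,
      inner_self_eq_norm_sq_to_K]
    rfl
  have h3 := h.le e g h1
  rw [h2, norm_pow, Complex.norm_real, norm_norm, h.norm_left, mul_one] at h3
  have h4 : inner ℂ f g = r := by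
    rw [hg, inner_sub_right, inner_smul_right, h.inner_eq_zero, mul_zero, sub_zero, h.inner_apply]
  have h5 : ‖g - (r : ℂ) • f‖ ^ 2 = ‖g‖ ^ 2 - r ^ 2 := by
    rw [@norm_sub_sq ℂ, inner_smul_right, ← inner_conj_symm, h4, norm_smul, h.norm_right,
      Complex.norm_real, Real.norm_of_nonneg h.nonneg, Complex.conj_ofReal, ← Complex.ofReal_mul]
    simp only [RCLike.re_to_complex, Complex.ofReal_re]
    ring
  have h6 : ‖g‖ ≤ r := by
    rcases (norm_nonneg g).eq_or_lt with h0 | h0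
    · rw [← h0]; exact h.nonneg
    · rw [pow_two] at h3; exact le_of_mul_le_mul_right h3 h0
  have h7 : g - (r : ℂ) • f = 0 := by
    rw [← norm_eq_zero, ← sq_eq_zero_iff]
    refine le_antisymm ?_ (sq_nonneg _)
    rw [h5]; nlinarith [norm_nonneg g]
  rw [← sub_eq_zero.1 h7, hg]; abel

/-- First-order optimality in the plane of `e` and `f`: equal diagonal entries. -/
theorem inner_apply_right_eq (h : IsExtremalPair C e f r) :
    inner ℂ f (C f) = inner ℂ e (C e) := by
  by_contra hne
  set δ := inner ℂ f (C f) - inner ℂ e (C e) with hδ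
  have hδ0 : 0 < ‖δ‖ ^ 2 := by
    have : δ ≠ 0 := sub_ne_zero.2 hne
    positivity
  set q := inner ℂ e (C f) with hq
  set t : ℝ := 1 / (‖q‖ + r + 1) with ht
  have hr := h.nonneg
  have ht0 : 0 < t := by positivity
  set τ : ℂ := t * conj δ with hτ
  have h1 : inner ℂ (f - conj τ • e) (e + τ • f) = 0 := by
    simp only [inner_sub_left, inner_add_right, inner_smul_left, inner_smul_right,
      h.inner_eq_zero, h.inner_eq_zero', h.inner_self_left, h.inner_self_right, Complex.conj_conj]
    ring
  have hτn : ‖τ‖ ^ 2 = t ^ 2 * ‖δ‖ ^ 2 := by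
    rw [hτ, norm_mul, Complex.norm_conj, Complex.norm_real, Real.norm_of_nonneg ht0.le, mul_pow]
  have h2 : ‖f - conj τ • e‖ ^ 2 = 1 + ‖τ‖ ^ 2 := by
    rw [@norm_sub_sq ℂ, inner_smul_right, h.inner_eq_zero, norm_smul, h.norm_left, h.norm_right,
      Complex.norm_conj]
    simp
  have h3 : ‖e + τ • f‖ ^ 2 = 1 + ‖τ‖ ^ 2 := by
    rw [@norm_add_sq ℂ, inner_smul_right, h.inner_eq_zero', norm_smul, h.norm_left, h.norm_right]
    simp
  have h4 : ‖f - conj τ • e‖ * ‖e + τ • f‖ = 1 + ‖τ‖ ^ 2 := by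
    have : ‖f - conj τ • e‖ = ‖e + τ • f‖ :=
      (sq_eq_sq₀ (norm_nonneg _) (norm_nonneg _)).1 (h2.trans h3.symm)
    rw [this, ← pow_two, h3]
  have h5 := h.le _ _ h1
  have h6 : inner ℂ (f - conj τ • e) (C (e + τ • f))
      = ((r + t * ‖δ‖ ^ 2 : ℝ) : ℂ) - τ ^ 2 * q := by
    simp only [map_add, map_smul, inner_sub_left, inner_add_right, inner_smul_left,
      inner_smul_right, Complex.conj_conj, h.inner_apply]
    push_cast
    rw [← Complex.conj_mul', ← hq]
    have : τ * inner ℂ f (C f) - τ * inner ℂ e (C e) = t * (conj δ * δ) := by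
      rw [← mul_sub, ← hδ, hτ]; ring
    linear_combination this
  rw [h4, h6] at h5
  have h7 : r + t * ‖δ‖ ^ 2 ≤ ‖((r + t * ‖δ‖ ^ 2 : ℝ) : ℂ) - τ ^ 2 * q‖ + ‖τ ^ 2 * q‖ := by
    have := norm_add_le (((r + t * ‖δ‖ ^ 2 : ℝ) : ℂ) - τ ^ 2 * q) (τ ^ 2 * q)
    rwa [sub_add_cancel, Complex.norm_real, Real.norm_of_nonneg (by positivity)] at this
  rw [norm_mul, norm_pow, hτn] at h7
  rw [hτn] at h5
  have h8 : t * (‖q‖ + r + 1) = 1 := by rw [ht]; field_simp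
  have h9 : t * ‖δ‖ ^ 2 ≤ (t * ‖δ‖ ^ 2) * (t * (‖q‖ + r)) := by nlinarith
  have h10 : 0 < t * ‖δ‖ ^ 2 := by positivity
  nlinarith

/-- Every number of modulus at most `r` is an off-diagonal entry `⟨f', C e'⟩`. -/
theorem exists_inner_eq (h : IsExtremalPair C e f r) {ξ : ℂ} (hξ : ‖ξ‖ ≤ r) :
    ∃ e' f' : H, ‖e'‖ = 1 ∧ ‖f'‖ = 1 ∧ inner ℂ f' e' = 0 ∧ inner ℂ f' (C e') = ξ := by
  set q := inner ℂ e (C f) with hq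
  -- Rotate `(e, f)` in its plane, with a phase `ω` for which `ω ^ 2 * q = ‖q‖`.
  obtain ⟨ω, hω, hωq⟩ : ∃ ω : ℂ, ‖ω‖ = 1 ∧ ω ^ 2 * q = ‖q‖ := by
    by_cases h0 : q = 0
    · exact ⟨1, by simp, by simp [h0]⟩
    obtain ⟨ω, hω⟩ := IsAlgClosed.exists_pow_nat_eq (‖q‖ / q : ℂ) (n := 2) (by norm_num)
    have hn : ‖q‖ ≠ 0 := norm_ne_zero_iff.2 h0
    refine ⟨ω, ?_, by rw [hω, div_mul_cancel₀ _ h0]⟩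
    have := congrArg norm hω
    rw [norm_pow, norm_div, Complex.norm_real, norm_norm, div_self hn] at this
    exact (pow_eq_one_iff_of_nonneg (norm_nonneg ω) two_ne_zero).1 this
  obtain ⟨φ, hφ, hφξ⟩ : ∃ φ : ℂ, ‖φ‖ = 1 ∧ φ * ‖ξ‖ = ξ := by
    by_cases h0 : ξ = 0
    · exact ⟨1, by simp, by simp [h0]⟩
    have hn : ‖ξ‖ ≠ 0 := norm_ne_zero_iff.2 h0
    refine ⟨ξ / ‖ξ‖, by rw [norm_div, Complex.norm_real, norm_norm, div_self hn], ?_⟩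
    rw [div_mul_cancel₀]; exact_mod_cast hn
  have hr := h.nonneg
  set S := (r - ‖ξ‖) / (r + ‖q‖) with hS
  have hS0 : 0 ≤ S := div_nonneg (by linarith) (by positivity)
  have hS1 : S ≤ 1 := div_le_one_of_le₀ (by linarith [norm_nonneg q, norm_nonneg ξ]) (by positivity)
  have hSr : r - S * (r + ‖q‖) = ‖ξ‖ := by
    by_cases h0 : r + ‖q‖ = 0
    · have : r = 0 := by linarith [norm_nonneg q]
      rw [h0, this]; linarith [norm_nonneg ξ]
    · rw [hS, div_mul_cancel₀ _ h0]; ring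
  obtain ⟨c, hc⟩ : ∃ c : ℝ, c = √(1 - S) := ⟨_, rfl⟩
  obtain ⟨s, hs⟩ : ∃ s : ℝ, s = √S := ⟨_, rfl⟩
  have hc2 : c ^ 2 = 1 - S := by rw [hc, Real.sq_sqrt (by linarith)]
  have hs2 : s ^ 2 = S := by rw [hs, Real.sq_sqrt hS0]
  have hcs : (c : ℂ) ^ 2 + (s : ℂ) ^ 2 = 1 := by
    exact_mod_cast (by rw [hc2, hs2]; ring : c ^ 2 + s ^ 2 = 1)
  have hωω : conj ω * ω = 1 := by rw [Complex.conj_mul', hω]; simp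
  have hφφ : conj φ * φ = 1 := by rw [Complex.conj_mul', hφ]; simp
  have hnorm : ∀ x : H, inner ℂ x x = (1 : ℂ) → ‖x‖ = 1 := fun x hx => by
    rw [@norm_eq_sqrt_re_inner ℂ, hx]; simp
  refine ⟨(c : ℂ) • e + (s * ω : ℂ) • f, conj φ • ((c : ℂ) • f - (s * conj ω : ℂ) • e),
    hnorm _ ?_, hnorm _ ?_, ?_, ?_⟩
  · simp only [inner_add_left, inner_add_right, inner_smul_left, inner_smul_right,
      h.inner_self_left, h.inner_self_right, h.inner_eq_zero, h.inner_eq_zero', map_mul,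
      Complex.conj_ofReal]
    linear_combination hcs + s ^ 2 * hωω
  · simp only [inner_sub_left, inner_sub_right, inner_smul_left, inner_smul_right,
      h.inner_self_left, h.inner_self_right, h.inner_eq_zero, h.inner_eq_zero', map_mul,
      Complex.conj_ofReal, Complex.conj_conj]
    linear_combination hcs + s ^ 2 * hωω + (c ^ 2 + s ^ 2 * (conj ω * ω)) * hφφ
  · simp only [inner_sub_left, inner_add_right, inner_smul_left, inner_smul_right,
      h.inner_self_left, h.inner_self_right, h.inner_eq_zero, h.inner_eq_zero', map_mul,
      Complex.conj_ofReal, Complex.conj_conj]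
    ring
  · have h1 : ((r - S * (r + ‖q‖) : ℝ) : ℂ) = ‖ξ‖ := by rw [hSr]
    have h2 : (s : ℂ) ^ 2 = S := by exact_mod_cast hs2
    simp only [map_add, map_smul, inner_sub_left, inner_add_right, inner_smul_left,
      inner_smul_right, map_mul, Complex.conj_ofReal, Complex.conj_conj, h.inner_apply,
      h.inner_apply_right_eq]
    rw [← hq, ← hφξ, ← h1]
    push_cast
    linear_combination φ * (r * hcs - s ^ 2 * hωq - (r + ‖q‖) * h2)

end IsExtremalPair

end

section

variable {H : Type v} [NormedAddCommGroup H] [InnerProductSpace ℂ H] [FiniteDimensional ℂ H]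

theorem exists_unit_orthogonal (hH : 2 ≤ Module.finrank ℂ H) (e : H) :
    ∃ f : H, ‖f‖ = 1 ∧ inner ℂ f e = 0 := by
  have h1 := (Submodule.span ℂ {e}).finrank_add_finrank_orthogonal
  have h2 : Module.finrank ℂ (Submodule.span ℂ {e}) ≤ 1 := by
    simpa using finrank_span_le_card (R := ℂ) ({e} : Set H)
  have h3 : 0 < Module.finrank ℂ (Submodule.span ℂ {e})ᗮ := by omega
  obtain ⟨⟨f, hf⟩, hf0⟩ := Module.finrank_pos_iff_exists_ne_zero.1 h3
  have hf0' : ‖f‖ ≠ 0 := by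
    rw [norm_ne_zero_iff]; rintro rfl; exact hf0 rfl
  refine ⟨((‖f‖⁻¹ : ℝ) : ℂ) • f, ?_, ?_⟩
  · rw [norm_smul, Complex.norm_real, norm_inv, norm_norm, inv_mul_cancel₀ hf0']
  · rw [inner_smul_left, Submodule.mem_orthogonal_singleton_iff_inner_left.1 hf, mul_zero]

theorem exists_isExtremalPair (hH : 2 ≤ Module.finrank ℂ H) (C : H →L[ℂ] H) :
    ∃ (e f : H) (r : ℝ), IsExtremalPair C e f r := by
  have : ProperSpace H := FiniteDimensional.proper ℂ H
  let S : Set (H × H) := {p | ‖p.1‖ = 1 ∧ ‖p.2‖ = 1 ∧ inner ℂ p.2 p.1 = 0}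
  have hSc : IsCompact S := by
    refine Metric.isCompact_of_isClosed_isBounded ?_ ?_
    · exact (isClosed_eq (by fun_prop) continuous_const).inter
        ((isClosed_eq (by fun_prop) continuous_const).inter
          (isClosed_eq (by fun_prop) continuous_const))
    · refine (Metric.isBounded_closedBall (x := (0 : H × H)) (r := 1)).subset fun p hp => ?_
      rw [mem_closedBall_zero_iff, Prod.norm_def, hp.1, hp.2.1, max_self]
  have hSn : S.Nonempty := by
    obtain ⟨e, he, -⟩ := exists_unit_orthogonal hH (0 : H)
    obtain ⟨f, hf, hfe⟩ := exists_unit_orthogonal hH e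
    exact ⟨(e, f), he, hf, hfe⟩
  obtain ⟨⟨e, f⟩, ⟨he, hf, hfe⟩, hmax⟩ := hSc.exists_isMaxOn hSn
    (f := fun p => ‖inner ℂ p.2 (C p.1)‖) (by fun_prop)
  simp only at he hf hfe
  obtain ⟨φ, hφ, hφv⟩ : ∃ φ : ℂ, ‖φ‖ = 1 ∧ conj φ * inner ℂ f (C e) = (‖inner ℂ f (C e)‖ : ℂ) := by
    by_cases h0 : inner ℂ f (C e) = 0
    · exact ⟨1, by simp, by simp [h0]⟩
    · have hn : ‖inner ℂ f (C e)‖ ≠ 0 := norm_ne_zero_iff.2 h0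
      refine ⟨inner ℂ f (C e) / ‖inner ℂ f (C e)‖, ?_, ?_⟩
      · rw [norm_div, Complex.norm_real, norm_norm, div_self hn]
      · rw [map_div₀, Complex.conj_ofReal, div_mul_eq_mul_div, Complex.conj_mul', pow_two,
          mul_div_assoc, div_self (by exact_mod_cast hn), mul_one]
  refine ⟨e, φ • f, ‖inner ℂ f (C e)‖, he, by rw [norm_smul, hφ, hf, one_mul],
    by rw [inner_smul_left, hfe, mul_zero], norm_nonneg _, by rw [inner_smul_left, hφv], ?_⟩
  intro x y hxy
  by_cases hx : x = 0
  · simp [hx]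
  by_cases hy : y = 0
  · simp [hy]
  have hx' : ‖x‖ ≠ 0 := norm_ne_zero_iff.2 hx
  have hy' : ‖y‖ ≠ 0 := norm_ne_zero_iff.2 hy
  have h1 := hmax (a := (((‖x‖⁻¹ : ℝ) : ℂ) • x, ((‖y‖⁻¹ : ℝ) : ℂ) • y)) (by
    refine ⟨?_, ?_, ?_⟩
    · simp [norm_smul, hx']
    · simp [norm_smul, hy']
    · simp [hxy])
  simp only [Set.mem_ofPred_eq, map_smul, inner_smul_left, inner_smul_right, norm_mul,
    Complex.norm_conj, Complex.norm_real, norm_inv, norm_norm] at h1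
  have h2 : ‖inner ℂ y (C x)‖ = (‖x‖⁻¹ * (‖y‖⁻¹ * ‖inner ℂ y (C x)‖)) * (‖y‖ * ‖x‖) := by
    field_simp
  rw [h2]
  gcongr

namespace IsExtremalPair

variable {C : H →L[ℂ] H} {e f : H} {r : ℝ}

theorem adjoint_pair (h : IsExtremalPair C e f r) :
    IsExtremalPair (adjoint C) f e r where
  norm_left := h.norm_right
  norm_right := h.norm_left
  inner_eq_zero := h.inner_eq_zero'
  nonneg := h.nonneg
  inner_apply := by
    rw [adjoint_inner_right, ← inner_conj_symm, h.inner_apply, Complex.conj_ofReal]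
  le := fun x y hxy => by
    rw [adjoint_inner_right, ← inner_conj_symm, Complex.norm_conj, mul_comm ‖y‖]
    exact h.le y x (by rw [← inner_conj_symm, hxy, map_zero])

end IsExtremalPair

theorem exists_isometryEquiv_map_pair (hH : 2 ≤ Module.finrank ℂ H) {e f e' f' : H}
    (he : ‖e‖ = 1) (hf : ‖f‖ = 1) (hef : inner ℂ f e = 0)
    (he' : ‖e'‖ = 1) (hf' : ‖f'‖ = 1) (hef' : inner ℂ f' e' = 0) :
    ∃ V : H ≃ₗᵢ[ℂ] H, V e = e' ∧ V f = f' := by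
  let i₀ : Fin (Module.finrank ℂ H) := ⟨0, by omega⟩
  let i₁ : Fin (Module.finrank ℂ H) := ⟨1, by omega⟩
  have hi : i₁ ≠ i₀ := by simp [i₀, i₁]
  have key : ∀ e f : H, ‖e‖ = 1 → ‖f‖ = 1 → inner ℂ f e = 0 →
      ∃ b : OrthonormalBasis (Fin (Module.finrank ℂ H)) ℂ H, b i₀ = e ∧ b i₁ = f := by
    intro e f he hf hef
    have hef' : inner ℂ e f = 0 := by rw [← inner_conj_symm, hef, map_zero]
    obtain ⟨b, hb⟩ := Orthonormal.exists_orthonormalBasis_extension_of_card_eq (𝕜 := ℂ) (E := H)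
      (ι := Fin (Module.finrank ℂ H)) (by simp) (v := fun i => if i = i₀ then e else f)
      (s := {i₀, i₁}) (by
        constructor
        · rintro ⟨i, rfl | rfl⟩
          · simp [he]
          · simp [hi, hf]
        · rintro ⟨i, rfl | rfl⟩ ⟨j, rfl | rfl⟩ hij
          · exact absurd rfl hij
          · simp [hi, hef']
          · simp [hi, hef]
          · exact absurd rfl hij)
    exact ⟨b, by simpa using hb i₀ (by simp), by simpa [hi] using hb i₁ (by simp)⟩
  obtain ⟨b, hb0, hb1⟩ := key e f he hf hef
  obtain ⟨b', hb0', hb1'⟩ := key e' f' he' hf' hef'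
  refine ⟨b.equiv b' (Equiv.refl _), ?_, ?_⟩
  · rw [← hb0, OrthonormalBasis.equiv_apply_basis, Equiv.refl_apply, hb0']
  · rw [← hb1, OrthonormalBasis.equiv_apply_basis, Equiv.refl_apply, hb1']

theorem opTrace_comp_compression_rankOne (C : H →L[ℂ] H) (V : H →ₗᵢ[ℂ] H) (a : ℂ) (e f : H) :
    opTrace H (C ∘L compression (a • rankOne ℂ (V e) (V f)) V) = a * inner ℂ f (C e) := by
  have : compression (a • rankOne ℂ (V e) (V f)) V = a • rankOne ℂ e f := by
    ext1 y
    refine ext_inner_left ℂ fun x => ?_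
    rw [inner_compression]
    simp [inner_smul_right]
  rw [this, comp_smul, map_smul, opTrace_comp_rankOne, smul_eq_mul]

/-- The numerical range of a nilpotent operator of rank one is a disc. -/
theorem IsExtremalPair.exists_trace_compression_eq_iff (hH : 2 ≤ Module.finrank ℂ H)
    {C : H →L[ℂ] H} {e f : H} {r : ℝ} (h : IsExtremalPair C e f r) {a : ℝ} (ha : 0 < a) (z : ℂ) :
    (∃ V : H →ₗᵢ[ℂ] H, opTrace H (C ∘L compression ((a : ℂ) • rankOne ℂ e f) V) = z)
      ↔ ‖z‖ ≤ a * r := by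
  constructor
  · rintro ⟨V, rfl⟩
    have hV : Function.Surjective V := (V.toLinearIsometryEquiv rfl).surjective
    obtain ⟨e', rfl⟩ := hV e
    obtain ⟨f', rfl⟩ := hV f
    rw [opTrace_comp_compression_rankOne, norm_mul, Complex.norm_real, Real.norm_of_nonneg ha.le]
    have h1 := h.le e' f' (by rw [← V.inner_map_map]; exact h.inner_eq_zero)
    have h2 := h.norm_left
    have h3 := h.norm_right
    rw [V.norm_map] at h2 h3
    rw [h2, h3, mul_one, mul_one] at h1
    gcongr
  · intro hz
    obtain ⟨e', f', he', hf', hef', hv⟩ := h.exists_inner_eq (ξ := z / a) (by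
      rw [norm_div, Complex.norm_real, Real.norm_of_nonneg ha.le, div_le_iff₀ ha, mul_comm]
      exact hz)
    obtain ⟨V, hVe, hVf⟩ := exists_isometryEquiv_map_pair hH he' hf' hef' h.norm_left h.norm_right
      h.inner_eq_zero
    refine ⟨V.toLinearIsometry, ?_⟩
    have h1 := opTrace_comp_compression_rankOne C V.toLinearIsometry a e' f'
    simp only [LinearIsometryEquiv.coe_toLinearIsometry, hVe, hVf] at h1
    rw [h1, hv, mul_div_cancel₀]
    exact_mod_cast ha.ne'

end

/-! ### Existence of a first- or second-order gain -/

section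

variable {H : Type v} [NormedAddCommGroup H] [InnerProductSpace ℂ H]

theorem exists_smul_eq_of_norm_inner_eq {u v : H} (hv : v ≠ 0)
    (h : ∀ w, ‖inner ℂ u w‖ = ‖inner ℂ v w‖) : ∃ ω : ℂ, ‖ω‖ = 1 ∧ u = ω • v := by
  have hvv : inner ℂ v v ≠ 0 := inner_self_ne_zero.2 hv
  have hv0 : ‖v‖ ≠ 0 := norm_ne_zero_iff.2 hv
  set ω := inner ℂ v u / inner ℂ v v with hω
  have h1 : inner ℂ v (u - ω • v) = 0 := by
    rw [inner_sub_right, inner_smul_right, hω, div_mul_cancel₀ _ hvv, sub_self]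
  have h2 : inner ℂ u (u - ω • v) = 0 := by
    rw [← norm_eq_zero, h, h1, norm_zero]
  have h3 : u - ω • v = 0 := by
    rw [← inner_self_eq_zero (𝕜 := ℂ), inner_sub_left, inner_smul_left, h1, h2, mul_zero, sub_zero]
  have h4 := sub_eq_zero.1 h3
  refine ⟨ω, ?_, h4⟩
  have h5 := h v
  rw [h4, inner_smul_left, norm_mul, Complex.norm_conj] at h5
  exact (mul_eq_right₀ (norm_ne_zero_iff.2 hvv)).1 h5

variable [FiniteDimensional ℂ H]

/-- If no choice of `a` allows a first-order gain, then `C` is normal and `C e` is a unimodular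
multiple of `C* f`. -/
theorem IsExtremalPair.normal_of_norm_sq_eq {C : H →L[ℂ] H} {e f : H} {r : ℝ}
    (h : IsExtremalPair C e f r) (hr : 0 < r)
    (hw : ∀ a : ℝ, 0 < a → a < 1 → ∀ w,
      ‖adjoint C w‖ ^ 2 - ‖(a : ℂ) • rankOne ℂ f e (adjoint C w)‖ ^ 2 =
      ‖C w‖ ^ 2 - ‖(a : ℂ) • rankOne ℂ e f (C w)‖ ^ 2) :
    (∀ w, ‖adjoint C w‖ = ‖C w‖) ∧ ∃ ω : ℂ, ‖ω‖ = 1 ∧ C e = (r : ℂ) • (ω • e + f) ∧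
      adjoint C f = conj ω • C e := by
  have key : ∀ w, ‖adjoint C w‖ ^ 2 = ‖C w‖ ^ 2 ∧
      ‖inner ℂ e (adjoint C w)‖ ^ 2 = ‖inner ℂ f (C w)‖ ^ 2 := by
    intro w
    have h1 := hw (1 / 2) (by norm_num) (by norm_num) w
    have h2 := hw (1 / 3) (by norm_num) (by norm_num) w
    simp only [rankOne_apply, norm_smul, Complex.norm_real, h.norm_left, h.norm_right] at h1 h2
    norm_num at h1 h2
    constructor <;> nlinarith
  refine ⟨fun w => (sq_eq_sq₀ (norm_nonneg _) (norm_nonneg _)).1 (key w).1, ?_⟩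
  have hCf := h.adjoint_pair.apply_eq
  have hCf0 : adjoint C f ≠ 0 := by
    intro h0
    have h3 := h.adjoint_pair.inner_apply
    rw [h0, inner_zero_right] at h3
    exact hr.ne (by exact_mod_cast h3)
  obtain ⟨ω, hω, hωe⟩ := exists_smul_eq_of_norm_inner_eq (u := C e) hCf0 (fun w => by
    rw [adjoint_inner_left, ← adjoint_inner_right]
    exact (sq_eq_sq₀ (norm_nonneg _) (norm_nonneg _)).1 (key w).2)
  have hωω : conj ω * ω = 1 := by rw [Complex.conj_mul', hω]; simp
  have hc : inner ℂ e (C e) = ω * r := by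
    rw [hωe, inner_smul_right, h.adjoint_pair.inner_apply]
  refine ⟨ω, hω, ?_, ?_⟩
  · rw [h.apply_eq, hc, smul_add, smul_smul, mul_comm]
  · rw [hωe, smul_smul, hωω, one_smul]

/-- In the remaining case there are vectors satisfying the second-order criterion, unless `C` is
a normal operator of rank one. -/
theorem IsExtremalPair.exists_second_order {C : H →L[ℂ] H} {e f : H} {r : ℝ}
    (h : IsExtremalPair C e f r) (hr : 0 < r) (hC : ∀ (μ : ℂ) (y : H), C ≠ μ • rankOne ℂ y y)
    (hnor : ∀ w, ‖adjoint C w‖ = ‖C w‖) {ω : ℂ} (hω : ‖ω‖ = 1)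
    (hCe : C e = (r : ℂ) • (ω • e + f)) (hCf : adjoint C f = conj ω • C e) :
    ∃ (a : ℝ) (v w : H), 0 < a ∧ a < 1 ∧ ‖w‖ = 1 ∧
      ‖adjoint C v‖ ^ 2 * (r / 2 * ‖inner ℂ w (ω • e + f)‖ ^ 2)
        < (1 - a ^ 2) * ‖inner ℂ e (adjoint C v)‖ ^ 2 * (conj ω * inner ℂ w (C w)).re := by
  have hωω : conj ω * ω = 1 := by rw [Complex.conj_mul', hω]; simp
  have hr0 : (r : ℂ) ≠ 0 := by exact_mod_cast hr.ne'
  have hee := h.inner_self_left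
  have hff := h.inner_self_right
  have hef := h.inner_eq_zero'
  have hfe := h.inner_eq_zero
  obtain ⟨y, hy⟩ : ∃ y, y = ω • e + f := ⟨_, rfl⟩
  rw [← hy] at hCe ⊢
  have hyy : inner ℂ y y = (2 : ℂ) := by
    rw [hy]
    simp only [inner_add_left, inner_add_right, inner_smul_left, inner_smul_right, hee, hff, hef,
      hfe]
    linear_combination hωω
  have hey : inner ℂ e y = ω := by
    rw [hy, inner_add_right, inner_smul_right, hee, hef]; ring
  have hyn : ‖y‖ ^ 2 = 2 := by
    rw [inner_self_eq_norm_sq_to_K] at hyy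
    exact Complex.ofReal_injective (by push_cast; exact hyy)
  have hyC : y = adjoint C ((ω / r : ℂ) • f) := by
    rw [map_smul, hCf, hCe, smul_smul, smul_smul]
    have : ω / r * conj ω * r = 1 := by field_simp; linear_combination hωω
    rw [this, one_smul]
  by_cases hk : C (e - conj ω • f) = 0
  · -- Here `y` is an eigenvector, and `w` is taken orthogonal to it.
    have hCy : C y = (2 * ω * r : ℂ) • y := by
      have h1 : C f = ω • C e := by
        rw [map_sub, map_smul, sub_eq_zero] at hk
        rw [hk, smul_smul, mul_comm, hωω, one_smul]
      rw [hy, map_add, map_smul, h1, hCe, ← hy, ← two_smul ℂ, smul_smul, smul_smul, mul_assoc]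
    have hCay : adjoint C y = (2 * conj ω * r : ℂ) • y := by
      have h1 : adjoint C (e - conj ω • f) = 0 := by
        rw [← norm_eq_zero, hnor, hk, norm_zero]
      have h2 : adjoint C e = conj ω • adjoint C f := by
        rwa [map_sub, map_smul, sub_eq_zero] at h1
      have h3 : ω • adjoint C e = adjoint C f := by
        rw [h2, smul_smul, mul_comm, hωω, one_smul]
      nth_rewrite 1 [hy]
      rw [map_add, map_smul, h3, hCf, hCe, ← two_smul ℂ, smul_smul, smul_smul, mul_assoc]
    obtain ⟨w, hwy, hw0⟩ : ∃ w, inner ℂ y w = 0 ∧ inner ℂ w (C w) ≠ 0 := by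
      by_contra! hcon
      refine hC (r * ω) y ?_
      rw [← sub_eq_zero, ← ContinuousLinearMap.coe_inj]
      refine (inner_map_self_eq_zero _).1 fun x => ?_
      obtain ⟨w, hw⟩ : ∃ w, w = x - (inner ℂ y x / 2) • y := ⟨_, rfl⟩
      have hyw : inner ℂ y w = 0 := by
        rw [hw, inner_sub_right, inner_smul_right, hyy]; ring
      have hyCw : inner ℂ y (C w) = 0 := by
        rw [← adjoint_inner_left, hCay, inner_smul_left, hyw, mul_zero]
      have hx : x = (inner ℂ y x / 2) • y + w := by rw [hw]; abel
      have h1 : (C - (r * ω : ℂ) • rankOne ℂ y y) x = C w := by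
        generalize inner ℂ y x / 2 = t at hx
        rw [hx]
        simp only [sub_apply, smul_apply, rankOne_apply, map_add, map_smul, hyy, hyw, hCy]
        module
      change inner ℂ ((C - (r * ω : ℂ) • rankOne ℂ y y) x) x = 0
      rw [h1, ← inner_conj_symm, hx, inner_add_left, inner_smul_left, hyCw, hcon w hyw]
      simp
    have hw1 : w ≠ 0 := by rintro rfl; simp at hw0
    have hwn : ‖w‖ ≠ 0 := norm_ne_zero_iff.2 hw1
    obtain ⟨w', hw'⟩ : ∃ w', w' = ((‖w‖⁻¹ : ℝ) : ℂ) • w := ⟨_, rfl⟩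
    have hw'n : ‖w'‖ = 1 := by
      rw [hw', norm_smul, Complex.norm_real, norm_inv, norm_norm, inv_mul_cancel₀ hwn]
    have hyw' : inner ℂ y w' = 0 := by rw [hw', inner_smul_right, hwy, mul_zero]
    have hw'y : inner ℂ w' y = 0 := by rw [← inner_conj_symm, hyw', map_zero]
    have hw'0 : inner ℂ w' (C w') ≠ 0 := by
      rw [hw', map_smul, inner_smul_left, inner_smul_right, Complex.conj_ofReal]
      have : ((‖w‖⁻¹ : ℝ) : ℂ) ≠ 0 := by exact_mod_cast inv_ne_zero hwn
      exact mul_ne_zero this (mul_ne_zero this hw0)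
    have hww : inner ℂ w' w' = (1 : ℂ) := by rw [inner_self_eq_norm_sq_to_K, hw'n]; simp
    have hyCw : inner ℂ y (C w') = 0 := by
      rw [← adjoint_inner_left, hCay, inner_smul_left, hyw', mul_zero]
    -- Extremality on the orthogonal pair `y ± √2 w'` forces `conj ω * ⟨w', C w'⟩` into the open
    -- right half-plane.
    have h22 : ((√2 : ℝ) : ℂ) * ((√2 : ℝ) : ℂ) = 2 := by
      rw [← Complex.ofReal_mul, Real.mul_self_sqrt (by norm_num)]; norm_num
    have h1 := h.le (y + ((√2 : ℝ) : ℂ) • w') (y - ((√2 : ℝ) : ℂ) • w') (by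
      simp only [inner_sub_left, inner_add_right, inner_smul_left, inner_smul_right, hyy, hyw',
        hw'y, hww, Complex.conj_ofReal]
      linear_combination -h22)
    have h2 : inner ℂ (y - ((√2 : ℝ) : ℂ) • w') (C (y + ((√2 : ℝ) : ℂ) • w'))
        = 2 * ω * (2 * r - conj ω * inner ℂ w' (C w')) := by
      simp only [inner_sub_left, inner_add_right, inner_smul_left, inner_smul_right, hyy,
        hw'y, map_add, map_smul, hCy, hyCw, Complex.conj_ofReal]
      linear_combination -(inner ℂ w' (C w')) * h22 + 2 * inner ℂ w' (C w') * hωω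
    have hs2 : ‖((√2 : ℝ) : ℂ) • w'‖ ^ 2 = 2 := by
      rw [norm_smul, hw'n, mul_one, Complex.norm_real, Real.norm_eq_abs, sq_abs,
        Real.sq_sqrt (by norm_num)]
    have h3 : ‖y + ((√2 : ℝ) : ℂ) • w'‖ ^ 2 = 2 ^ 2 := by
      rw [@norm_add_sq ℂ, inner_smul_right, hyw', hs2, hyn]; norm_num
    have h4 : ‖y - ((√2 : ℝ) : ℂ) • w'‖ ^ 2 = 2 ^ 2 := by
      rw [@norm_sub_sq ℂ, inner_smul_right, hyw', hs2, hyn]; norm_num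
    rw [sq_eq_sq₀ (norm_nonneg _) (by norm_num)] at h3 h4
    rw [h2, h3, h4, norm_mul, norm_mul, hω, Complex.norm_ofNat] at h1
    have hR : 0 < (conj ω * inner ℂ w' (C w')).re := by
      have hγ0 : conj ω * inner ℂ w' (C w') ≠ 0 := by
        refine mul_ne_zero ?_ hw'0
        rintro h0; rw [h0] at hωω; simp at hωω
      generalize conj ω * inner ℂ w' (C w') = γ at h1 hγ0
      have h5 : ‖(2 * r - γ : ℂ)‖ ≤ 2 * r := by linarith
      have h6 : ‖(2 * r - γ : ℂ)‖ ^ 2 ≤ (2 * r) ^ 2 := by gcongr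
      have h7 : ‖(2 * r - γ : ℂ)‖ ^ 2 = (2 * r) ^ 2 - 4 * r * γ.re + ‖γ‖ ^ 2 := by
        rw [Complex.sq_norm, Complex.sq_norm, Complex.normSq_apply, Complex.normSq_apply]
        simp
        ring
      have h8 : 0 < ‖γ‖ ^ 2 := by positivity
      have h9 : 0 < 4 * r * γ.re := by linarith
      exact pos_of_mul_pos_right h9 (by positivity)
    refine ⟨1 / 2, (ω / r : ℂ) • f, w', by norm_num, by norm_num, hw'n, ?_⟩
    rw [← hyC, hw'y, hey, hω]
    simp only [norm_zero]
    norm_num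
    simpa using hR
  · -- Here `w` and `C* v` are multiples of the projection of `e` to the range of `C*`.
    obtain ⟨v, hv⟩ : ∃ v, ∀ u, inner ℂ (adjoint C v) (adjoint C u) = inner ℂ e (adjoint C u) := by
      let P := LinearMap.range (adjoint C).toLinearMap
      obtain ⟨v, hv⟩ : P.starProjection e ∈ P := P.starProjection_apply_mem e
      refine ⟨v, fun u => ?_⟩
      have h1 : inner ℂ (e - P.starProjection e) (adjoint C u) = 0 :=
        P.starProjection_inner_eq_zero e (adjoint C u) ⟨u, rfl⟩
      have h2 : adjoint C v = P.starProjection e := hv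
      rw [h2, ← sub_eq_zero, ← inner_sub_left, ← neg_eq_zero, ← inner_neg_left, neg_sub, h1]
    obtain ⟨x, hx⟩ : ∃ x, x = adjoint C v := ⟨_, rfl⟩
    have hxy : inner ℂ x y = ω := by rw [hyC, hx, hv, ← hyC, hey]
    have hxx : inner ℂ e x = (‖x‖ ^ 2 : ℂ) := by
      nth_rewrite 1 [hx]
      rw [← hv, ← hx, inner_self_eq_norm_sq_to_K]; rfl
    have hCx : C x = C e := by
      rw [← sub_eq_zero, ← map_sub, ← inner_self_eq_zero (𝕜 := ℂ), ← adjoint_inner_right,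
        inner_sub_left, hx, hv, sub_self]
    -- `‖x‖ ^ 2 ≤ 1 / 2` would force `x = conj ω • y / 2`.
    have hx2 : 1 / 2 < ‖x‖ ^ 2 := by
      by_contra hle
      have h1 : ‖x - (conj ω / 2) • y‖ ^ 2 = ‖x‖ ^ 2 - 1 / 2 := by
        rw [@norm_sub_sq ℂ, inner_smul_right, hxy, norm_smul, mul_pow, hyn, norm_div,
          Complex.norm_conj, hω, div_mul_eq_mul_div, hωω]
        norm_num
        ring
      have h2 : x = (conj ω / 2) • y := by
        rw [← sub_eq_zero, ← norm_eq_zero, ← sq_eq_zero_iff]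
        exact le_antisymm (by rw [h1]; linarith) (sq_nonneg _)
      apply hk
      have h3 : C e = (conj ω / 2) • (ω • C e + C f) := by
        rw [← map_smul, ← map_add, ← hy, ← map_smul, ← h2, hCx]
      rw [smul_add, smul_smul, div_mul_eq_mul_div, hωω] at h3
      have h4 : C e - (1 / 2 : ℂ) • C e = (conj ω / 2) • C f := sub_eq_iff_eq_add'.2 h3
      rw [map_sub, map_smul]
      have h5 : C e - conj ω • C f
          = (2 : ℂ) • ((C e - (1 / 2 : ℂ) • C e) - (conj ω / 2) • C f) := by module
      rw [h5, h4, sub_self, smul_zero]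
    have hxn : 0 < ‖x‖ := by
      rcases (norm_nonneg x).eq_or_lt with h0 | h0
      · rw [← h0] at hx2; norm_num at hx2
      · exact h0
    obtain ⟨w, hw⟩ : ∃ w, w = ((‖x‖⁻¹ : ℝ) : ℂ) • x := ⟨_, rfl⟩
    have hwn : ‖w‖ = 1 := by
      rw [hw, norm_smul, Complex.norm_real, norm_inv, norm_norm, inv_mul_cancel₀ hxn.ne']
    obtain ⟨S, hS⟩ : ∃ S, S = ‖x‖ ^ 2 := ⟨_, rfl⟩
    rw [← hS] at hx2
    -- With this `a < 1` one has `a ^ 2 * S ≤ a * S < S - 1 / 2`.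
    refine ⟨(S - 1 / 2) / (2 * S), v, w, div_pos (by linarith) (by linarith), ?_, hwn, ?_⟩
    · rw [div_lt_one (by linarith)]; linarith
    have hwy : ‖inner ℂ w y‖ ^ 2 = S⁻¹ := by
      rw [hw, inner_smul_left, hxy, norm_mul, hω, Complex.norm_conj, Complex.norm_real, norm_inv,
        norm_norm, mul_one, inv_pow, hS]
    have hwC : (conj ω * inner ℂ w (C w)).re = r * S⁻¹ := by
      have h1 : conj ω * inner ℂ w (C w) = ((r * S⁻¹ : ℝ) : ℂ) := by
        rw [hw, map_smul, hCx, hCe, inner_smul_left, inner_smul_right, inner_smul_right, hxy, hS,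
          Complex.conj_ofReal]
        push_cast
        linear_combination ((‖x‖ : ℂ)⁻¹ ^ 2 * r) * hωω
      rw [h1, Complex.ofReal_re]
    have hxe : ‖inner ℂ e x‖ ^ 2 = S ^ 2 := by
      rw [hxx, norm_pow, Complex.norm_real, norm_norm, hS]
    rw [← hx, ← hS, hwy, hwC, hxe]
    have hS0 : S ≠ 0 := by linarith
    obtain ⟨a, ha⟩ : ∃ a, a = (S - 1 / 2) / (2 * S) := ⟨_, rfl⟩
    rw [← ha]
    have ha1 : a * (2 * S) = S - 1 / 2 := by rw [ha]; field_simp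
    have ha0 : 0 < a := by rw [ha]; exact div_pos (by linarith) (by linarith)
    have ha2 : a < 1 := by rw [ha, div_lt_one (by linarith)]; linarith
    have e1 : S * (r / 2 * S⁻¹) = r * (1 / 2) := by field_simp
    have e2 : (1 - a ^ 2) * S ^ 2 * (r * S⁻¹) = r * ((1 - a ^ 2) * S) := by field_simp
    rw [e1, e2]
    refine mul_lt_mul_of_pos_left ?_ hr
    have : a ^ 2 * S ≤ a * S := by nlinarith
    nlinarith

theorem IsExtremalPair.exists_exceedsOnDilations {C : H →L[ℂ] H} {e f : H} {r : ℝ}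
    (h : IsExtremalPair C e f r) (hr : 0 < r) (hC : ∀ (μ : ℂ) (y : H), C ≠ μ • rankOne ℂ y y) :
    ∃ a : ℝ, 0 < a ∧ a ≤ 1 ∧ ExceedsOnDilations.{u} C ((a : ℂ) • rankOne ℂ e f) (a * r) := by
  by_cases hw : ∃ a : ℝ, 0 < a ∧ a < 1 ∧ ∃ w,
      ‖adjoint C w‖ ^ 2 - ‖(a : ℂ) • rankOne ℂ f e (adjoint C w)‖ ^ 2 ≠
      ‖C w‖ ^ 2 - ‖(a : ℂ) • rankOne ℂ e f (C w)‖ ^ 2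
  · obtain ⟨a, ha, ha1, w, hw⟩ := hw
    exact ⟨a, ha, ha1.le, exceedsOnDilations_of_norm_sq_ne C h.norm_right h.inner_eq_zero
      (mul_pos ha hr) h.inner_apply hw⟩
  · push Not at hw
    obtain ⟨hnor, ω, hω, hCe, hCf⟩ := h.normal_of_norm_sq_eq hr hw
    obtain ⟨a, v, w, ha, ha1, hwn, hlt⟩ := h.exists_second_order hr hC hnor hω hCe hCf
    exact ⟨a, ha, ha1.le, exceedsOnDilations_of_second_order C h.norm_left h.norm_right
      h.inner_eq_zero ha ha1 hr hω hCe hCf hwn hlt⟩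

end

/-! ### Scalar operators, and the matrix statement -/

/-- The numerical range of the matrix `!![0, 0; 1, s]` with `‖s‖ ≤ 1` contains a disc about `0`. -/
theorem exists_unit_quadratic_eq {s ζ : ℂ} (hs : ‖s‖ ≤ 1) (hζ : ‖ζ‖ ≤ 1 / 10) (hζ0 : ζ ≠ 0) :
    ∃ (α : ℂ) (β : ℝ), ‖α‖ ^ 2 + β ^ 2 = 1 ∧ α * β + s * β ^ 2 = ζ := by
  let φ : ℝ → ℝ := fun β => ‖ζ - s * β ^ 2‖ ^ 2 + β ^ 4 - β ^ 2
  have hφ : Continuous φ := by fun_prop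
  have h0 : 0 ≤ φ 0 := by simp [φ]
  have h1 : φ (1 / 2) ≤ 0 := by
    have h2 : ‖ζ - s * ((1 / 2 : ℝ) : ℂ) ^ 2‖ ≤ 1 / 10 + 1 / 4 := by
      refine (norm_sub_le _ _).trans ?_
      rw [norm_mul, norm_pow, Complex.norm_real]
      norm_num
      linarith
    have h3 : ‖ζ - s * ((1 / 2 : ℝ) : ℂ) ^ 2‖ ^ 2 ≤ (1 / 10 + 1 / 4) ^ 2 := by gcongr
    simp only [φ]
    linarith
  obtain ⟨β, hβ, hβ0⟩ := intermediate_value_Icc' (by norm_num : (0 : ℝ) ≤ 1 / 2) hφ.continuousOn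
    (Set.mem_Icc.2 ⟨h1, h0⟩)
  have hβne : β ≠ 0 := by
    rintro rfl
    simp [φ, hζ0] at hβ0
  have hβc : (β : ℂ) ≠ 0 := by exact_mod_cast hβne
  refine ⟨(ζ - s * β ^ 2) / β, β, ?_, ?_⟩
  · rw [norm_div, Complex.norm_real, div_pow, Real.norm_eq_abs, sq_abs]
    field_simp
    simp only [φ] at hβ0
    linarith
  · field_simp
    ring

theorem exists_unit_inner_apply_ne_zero {H : Type v} [NormedAddCommGroup H]
    [InnerProductSpace ℂ H] {C : H →L[ℂ] H} (hC : C ≠ 0) :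
    ∃ e : H, ‖e‖ = 1 ∧ inner ℂ e (C e) ≠ 0 := by
  by_contra! hcon
  apply hC
  rw [← ContinuousLinearMap.coe_inj]
  refine (inner_map_self_eq_zero _).1 fun x => ?_
  change inner ℂ (C x) x = 0
  by_cases hx : x = 0
  · simp [hx]
  have hxn : ‖x‖ ≠ 0 := norm_ne_zero_iff.2 hx
  have h1 := hcon (((‖x‖⁻¹ : ℝ) : ℂ) • x) (by
    rw [norm_smul, Complex.norm_real, norm_inv, norm_norm, inv_mul_cancel₀ hxn])
  have h2 : ((‖x‖⁻¹ : ℝ) : ℂ) ≠ 0 := by exact_mod_cast inv_ne_zero hxn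
  rw [map_smul, inner_smul_left, inner_smul_right, Complex.conj_ofReal, mul_eq_zero, mul_eq_zero,
    or_iff_right h2, or_iff_right h2] at h1
  rw [← inner_conj_symm, h1, map_zero]

section

variable {H : Type v} [NormedAddCommGroup H] [InnerProductSpace ℂ H] [FiniteDimensional ℂ H]

/-- The case where `e` is an eigenvector of `C` and `C*`, with `a = 1`: a unitary dilation `U` of
`e f*` maps `f` to `e` and `e` to a vector orthogonal to the whole space. -/
theorem exceedsOnDilations_of_eigenvector (C : H →L[ℂ] H) {e f : H} (he : ‖e‖ = 1) (hf : ‖f‖ = 1)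
    (hfe : inner ℂ f e = 0) {c : ℂ} (hc : c ≠ 0) (hCe : C e = c • e)
    (hCae : adjoint C e = conj c • e) :
    ExceedsOnDilations.{u} C (((1 : ℝ) : ℂ) • rankOne ℂ e f) 0 := by
  have hcn : 0 < ‖c‖ := norm_pos_iff.2 hc
  refine ⟨‖c‖ / 10, by positivity, fun K _ _ _ U V hU hT d hd hdd => ?_⟩
  rw [Complex.ofReal_one, one_smul] at hT
  have htr : opTrace H (C ∘L compression U V) = 0 := by
    rw [hT, opTrace_comp_rankOne, hCe, inner_smul_right, hfe, mul_zero]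
  rcases hd.eq_or_lt with rfl | hd0
  · exact ⟨V, by rw [htr]; simp⟩
  have hee : inner ℂ e e = (1 : ℂ) := by rw [inner_self_eq_norm_sq_to_K, he]; simp
  have hff : inner ℂ f f = (1 : ℂ) := by rw [inner_self_eq_norm_sq_to_K, hf]; simp
  have hUi := inner_map_map_of_mem_unitary hU
  obtain ⟨g, hg⟩ : ∃ g, g = U (V e) := ⟨_, rfl⟩
  have hgn : ‖g‖ = 1 := by rw [hg, norm_map_of_mem_unitary hU, V.norm_map, he]
  have hVg : ∀ x, inner ℂ (V x) g = 0 := fun x => by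
    rw [hg, ← inner_compression, hT, rankOne_apply, hfe, zero_smul, inner_zero_right]
  have hUf : U (V f) = V e := by
    have h1 := norm_sq_defectVector hUi V f
    rw [hT, rankOne_apply, hff, one_smul, he, hf, sub_self, sq_eq_zero_iff, norm_eq_zero,
      defectVector_apply, hT, rankOne_apply, hff, one_smul, sub_eq_zero] at h1
    exact h1
  have hEg : inner ℂ (V e) (U g) = 0 := by rw [← hUf, hUi, hVg]
  have hgg : inner ℂ g g = (1 : ℂ) := by rw [inner_self_eq_norm_sq_to_K, hgn]; simp
  have hs : ‖inner ℂ g (U g)‖ ≤ 1 := by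
    have := norm_inner_apply_le_of_isometry (norm_map_of_mem_unitary hU) g g
    rwa [hgn, one_mul] at this
  obtain ⟨α, β, hαβ, hd'⟩ := exists_unit_quadratic_eq (s := inner ℂ g (U g)) (ζ := d / c) hs
    (by
      rw [norm_div, Complex.norm_real, Real.norm_of_nonneg hd, div_le_iff₀ hcn]
      linarith)
    (div_ne_zero (by exact_mod_cast hd0.ne') hc)
  obtain ⟨V', hV'⟩ := exists_rotated_isometry V he hgn hVg (c := α) (s := (β : ℂ)) (by
    rwa [Complex.norm_real, Real.norm_eq_abs, sq_abs])
  refine ⟨V', ?_⟩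
  have hVee : inner ℂ (V e) (V e) = (1 : ℂ) := by rw [V.inner_map_map, hee]
  rw [opTrace_comp_compression_of_apply_eq C U V V' e _ hV', htr, hCe, hCae]
  simp only [map_add, map_smul, inner_add_left, inner_add_right, inner_smul_left,
    inner_smul_right, Complex.conj_conj, ← hg, hVg, hEg, hgg, hee, map_sub,
    Complex.conj_ofReal]
  rw [eq_div_iff hc] at hd'
  push_cast
  linear_combination hd'

/-- For every `C ≠ 0` that is not a normal operator of rank one there is a nilpotent operator
`a e f*` as required. -/
theorem exists_extremalPair_exceedsOnDilations (hH : 2 ≤ Module.finrank ℂ H) {C : H →L[ℂ] H}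
    (hC0 : C ≠ 0) (hC : ∀ (μ : ℂ) (y : H), C ≠ μ • rankOne ℂ y y) :
    ∃ (e f : H) (r a : ℝ), IsExtremalPair C e f r ∧ 0 < a ∧ a ≤ 1 ∧
      ExceedsOnDilations.{u} C ((a : ℂ) • rankOne ℂ e f) (a * r) := by
  obtain ⟨e, f, r, h⟩ := exists_isExtremalPair hH C
  rcases h.nonneg.lt_or_eq with hr | rfl
  · obtain ⟨a, ha, ha1, hex⟩ := h.exists_exceedsOnDilations hr hC
    exact ⟨e, f, r, a, h, ha, ha1, hex⟩
  -- If the maximum is `0`, then `C` is scalar and all orthonormal pairs are extremal.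
  obtain ⟨e', he', hc⟩ := exists_unit_inner_apply_ne_zero hC0
  obtain ⟨f', hf', hfe'⟩ := exists_unit_orthogonal hH e'
  have h' : IsExtremalPair C e' f' 0 :=
    ⟨he', hf', hfe', le_rfl, by simpa using h.le e' f' hfe', h.le⟩
  refine ⟨e', f', 0, 1, h', one_pos, le_rfl, ?_⟩
  have h1 := h'.apply_eq
  have h2 : IsExtremalPair (adjoint C) e' f' 0 :=
    ⟨he', hf', hfe', le_rfl, by simpa using h.adjoint_pair.le e' f' hfe', h.adjoint_pair.le⟩
  have h3 := h2.apply_eq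
  rw [Complex.ofReal_zero, zero_smul, add_zero] at h1 h3
  rw [adjoint_inner_right, ← inner_conj_symm] at h3
  rw [mul_zero]
  exact exceedsOnDilations_of_eigenvector C he' hf' hfe' hc h1 h3

end

section

variable {n : ℕ}

theorem exists_matOp_eq (L : EuclideanSpace ℂ (Fin n) →L[ℂ] EuclideanSpace ℂ (Fin n)) :
    ∃ A : Matrix (Fin n) (Fin n) ℂ, matOp A = L :=
  (Matrix.toEuclideanCLM (n := Fin n) (𝕜 := ℂ)).surjective L

theorem matOp_injective : Function.Injective (matOp (n := n)) :=
  (Matrix.toEuclideanCLM (n := Fin n) (𝕜 := ℂ)).injective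

theorem matOp_zero : matOp (0 : Matrix (Fin n) (Fin n) ℂ) = 0 :=
  map_zero (Matrix.toEuclideanCLM (n := Fin n) (𝕜 := ℂ))

theorem matOp_mul (A B : Matrix (Fin n) (Fin n) ℂ) : matOp (A * B) = matOp A ∘L matOp B :=
  map_mul (Matrix.toEuclideanCLM (n := Fin n) (𝕜 := ℂ)) A B

theorem rank_eq_one_of_matOp_eq {A : Matrix (Fin n) (Fin n) ℂ} (hA : A ≠ 0) {μ : ℂ}
    {x y : EuclideanSpace ℂ (Fin n)} (h : matOp A = μ • rankOne ℂ x y) : A.rank = 1 := by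
  have h1 : A = Matrix.vecMulVec (μ • x.ofLp) (star y.ofLp) := by
    apply matOp_injective
    rw [h]
    ext1 z
    ext i
    simp [Matrix.vecMulVec_mulVec, EuclideanSpace.inner_eq_star_dotProduct, dotProduct_comm]
    left; ring
  refine le_antisymm ?_ ?_
  · rw [h1]; exact Matrix.rank_vecMulVec_le _ _
  · rw [Nat.one_le_iff_ne_zero]
    intro h0
    rw [Matrix.rank, Submodule.finrank_eq_zero, LinearMap.range_eq_bot] at h0
    exact hA (Matrix.toLin'.injective (h0.trans (map_zero _).symm))

theorem isStarNormal_of_matOp_eq {A : Matrix (Fin n) (Fin n) ℂ} {μ : ℂ}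
    {y : EuclideanSpace ℂ (Fin n)} (h : matOp A = μ • rankOne ℂ y y) : IsStarNormal A := by
  have hs : matOp (star A) = conj μ • rankOne ℂ y y := by
    have : matOp (star A) = star (matOp A) :=
      map_star (Matrix.toEuclideanCLM (n := Fin n) (𝕜 := ℂ)) A
    rw [this, h, star_smul, star_eq_adjoint, adjoint_rankOne]; rfl
  refine ⟨matOp_injective ?_⟩
  rw [matOp_mul, matOp_mul, hs, h]
  simp only [comp_smul, smul_comp, smul_smul, mul_comm]

theorem cNumericalRange_subset_of_isDilation (C : Matrix (Fin n) (Fin n) ℂ) {H : Type v}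
    [NormedAddCommGroup H] [InnerProductSpace ℂ H] [CompleteSpace H] {K : Type w}
    [NormedAddCommGroup K] [InnerProductSpace ℂ K] [CompleteSpace K] {S : K →L[ℂ] K}
    {T : H →L[ℂ] H} (h : IsDilation S T) : cNumericalRange C T ⊆ cNumericalRange C S := by
  obtain ⟨X, rfl⟩ := h
  intro z hz
  rw [mem_cNumericalRange_iff] at hz ⊢
  obtain ⟨V, rfl⟩ := hz
  refine ⟨X.comp V, ?_⟩
  congr 2
  ext1 y
  refine ext_inner_left ℂ fun x => ?_
  rw [inner_compression, inner_compression]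
  exact (inner_compression S X (V x) (V y)).symm

end

theorem theorem1p2 (n : ℕ) (hn : 2 ≤ n) (C : Matrix (Fin n) (Fin n) ℂ) (hC : C ≠ 0)
    (hC1 : ¬ (C.rank = 1 ∧ IsStarNormal C)) :
    ∃ T : Matrix (Fin n) (Fin n) ℂ,
      T.rank = 1 ∧ IsNilpotent T ∧ ‖matOp T‖ ≤ 1 ∧
      (∃ r : ℝ, 0 ≤ r ∧ cNumericalRange C (matOp T) = Metric.closedBall (0 : ℂ) r ∧
        ∃ d : ℝ, 0 < d ∧
          ∀ (K : Type u) [NormedAddCommGroup K] [InnerProductSpace ℂ K] [CompleteSpace K]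
            (U : K →L[ℂ] K), IsUnitaryDilation U (matOp T) →
              ((r + d : ℝ) : ℂ) ∈ closure (cNumericalRange C U)) ∧
      cNumericalRange C (matOp T) = closure (cNumericalRange C (matOp T)) ∧
      cNumericalRange C (matOp T) ⊂ dilationIntersection.{u} C (matOp T) := by
  have hH : 2 ≤ Module.finrank ℂ (EuclideanSpace ℂ (Fin n)) := by simpa using hn
  have hC0 : matOp C ≠ 0 := fun h0 => hC (matOp_injective (h0.trans matOp_zero.symm))
  obtain ⟨e, f, r, a, h, ha, ha1, d, hd, hex⟩ :=
    exists_extremalPair_exceedsOnDilations.{u} hH hC0 fun μ y hμ =>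
      hC1 ⟨rank_eq_one_of_matOp_eq hC hμ, isStarNormal_of_matOp_eq hμ⟩
  obtain ⟨T, hT⟩ := exists_matOp_eq ((a : ℂ) • rankOne ℂ e f)
  have hT0 : T ≠ 0 := by
    rintro rfl
    rw [matOp_zero] at hT
    have h1 := congrArg norm hT
    rw [norm_smul, norm_rankOne, h.norm_left, h.norm_right, Complex.norm_real,
      Real.norm_of_nonneg ha.le, norm_zero] at h1
    linarith
  have hr : 0 ≤ a * r := mul_nonneg ha.le h.nonneg
  have hball : cNumericalRange C (matOp T) = Metric.closedBall (0 : ℂ) (a * r) := by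
    ext z
    rw [mem_cNumericalRange_iff, hT, h.exists_trace_compression_eq_iff hH ha,
      mem_closedBall_zero_iff]
  have hdil : ∀ (K : Type u) [NormedAddCommGroup K] [InnerProductSpace ℂ K] [CompleteSpace K]
      (U : K →L[ℂ] K), IsUnitaryDilation U (matOp T) →
        ((a * r + d : ℝ) : ℂ) ∈ closure (cNumericalRange C U) := by
    rintro K _ _ _ U ⟨hU, V, hV⟩
    refine subset_closure ((mem_cNumericalRange_iff C U _).2 ?_)
    obtain ⟨V', hV'⟩ := hex K U V hU (hV.trans hT) d hd.le le_rfl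
    exact ⟨V', by rw [hV', Complex.ofReal_add]⟩
  refine ⟨T, rank_eq_one_of_matOp_eq hT0 hT, ⟨2, matOp_injective ?_⟩, ?_,
    ⟨a * r, hr, hball, d, hd, hdil⟩, ?_, ?_⟩
  · rw [pow_two, matOp_mul, hT, matOp_zero]
    ext1 x
    simp [h.inner_eq_zero]
  · rw [hT, norm_smul, norm_rankOne, h.norm_left, h.norm_right, Complex.norm_real,
      Real.norm_of_nonneg ha.le]
    linarith
  · rw [hball, Metric.isClosed_closedBall.closure_eq]
  · rw [Set.ssubset_iff_of_subset]
    · refine ⟨((a * r + d : ℝ) : ℂ), hdil, ?_⟩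
      rw [hball, mem_closedBall_zero_iff, Complex.norm_real, Real.norm_of_nonneg (by linarith)]
      linarith
    · intro z hz K _ _ _ U hU
      exact subset_closure (cNumericalRange_subset_of_isDilation C hU.2 hz)
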